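/- Let $G=\langle a,b,c,d\mid abABcdCD=1\rangle$ be the fundamental group of the closed orientable surface of genus $2$, with capital letters denoting inverses, and let $\Omega=\{a,b,c,d,A,B,C,D\}$. The Cayley graph of $G$ is embedded in the hyperbolic plane so that its faces are octagons whose counterclockwise boundary reads the cyclic word $abABcdCD$; the edges leaving a vertex are then, in counterclockwise cyclic order, $a,d,C,D,c,b,A,B$. Write $\bar x$ for the inverse of $x\in\Omega$. **The Markov chain.** The alphabet $\mathbb A$ has $88$ states: $A_x$; $A'^L_x,A'^R_x$; $A''^L_x,A''^R_x$ ($x\in\Omega$); $B_{jk}$, for the $8$ pairs such that the edge $j$ comes immediately after (to the left of) $k$ in the counterclockwise order of the edges leaving a vertex; $C_{jk}$, $C'_{jk}$, $D_{jk}$, obtained from $B_{jk}$ by moving one, two, three edges further along the octagon between the edges $j$ and $k$, counterclockwise on the right branch ($k$) and clockwise on the left branch ($j$); and $E^L_{xyz},E^R_{xyz}$ ($y\in\Omega$), three edges from left to right with middle edge $y$, where in $E^L$ the edges $x,y$ leave the same vertex and are adjacent there and $y,z$ end at the same vertex of an octagon having both on its boundary, while in $E^R$ the edges $y,z$ leave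 the same vertex and $x,y$ end at the same vertex. The transitions are as follows. Number the seven edges other than $\bar x$ leaving the end of an edge $x$ from right to left (counterclockwise, starting after $\bar x$) by $e_1,\dots,e_7$. * $A_x$ is followed by $A'^R_{e_1}$, $A'^L_{e_7}$, $A_{e_2},\dots,A_{e_6}$ or $B_{e_{i+1}e_i}$ $(1\le i\le 6)$. * $A'^L_x$ is followed by the same states with $A''^L_{e_7}$ in place of $A'^L_{e_7}$; $A'^R_x$ by the same states as $A_x$ with $A''^R_{e_1}$ in place of $A'^R_{e_1}$. * $A''^L_x$ is followed by $A'^R_{e_1}$, $A_{e_2},\dots,A_{e_6}$ or $B_{e_{i+1}e_i}$ $(1\le i\le5)$; $A''^R_x$ by $A'^L_{e_7}$, $A_{e_2},\dots,A_{e_6}$ or $B_{e_{i+1}e_i}$ $(2\le i\le 6)$. * $D_{jk}$ is followed, with $e_1,\dots,e_6$ the six edges other than $\bar j,\bar k$ leaving the common end of $j$ and $k$, counterclockwise starting after $\bar k$, by $A'^R_{e_1}$, $A'^L_{e_6}$, $A_{e_2},\dots,A_{e_5}$ or $B_{e_{i+1}e_i}$ $(1\le i\le 5)$. * $B_{jk}$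 is followed by $C$, and $C$ by $C'$, with both edges moved one edge further along the octagon; $C'$ is followed, with $j,k$ the next edges along the octagon (which end at the same vertex), by $D_{jk}$, by $E^L_{xjk}$, or by $E^R_{jkz}$, where $x$ is the edge adjacent to $j$ on its left at its initial vertex and $z$ the edge adjacent to $k$ on its right at its initial vertex. * $E^L_{xyz}$ (respectively $E^R_{xyz}$) is followed by the state $C$ that follows $B_{xy}$ (respectively $B_{yz}$). Let $\mathbf X$ be the space of bi-infinite sequences $(x_i)_{i\in\mathbb Z}$ of states satisfying these rules, $(\tau x)_i=x_{i+1}$ the shift, and $(a_{ij})$ the $0$–$1$ transition matrix. Let $\Lambda$ be its dominant eigenvalue, with positive left and right eigenvectors $u$, $v$ normalized by $\sum_i u_iv_i=1$. The Parry measure $\nu$ on $\mathbf X$ is the law of the two-sided stationary Markov chain with stationary vector $\pi_i=u_iv_i$ and transition probabilities $q_{ij}=a_{ij}v_j/(\Lambda v_i)$. **Spines.** Let $\phi$ map $A_x,A'^{L}_x,A'^{R}_x,A''^{L}_x,A''^{R}_x\mapsto\alpha_x$, $B_{xy}\mapsto\beta_{xy}$, $C_{xy},C'_{xy}\mapsto\gamma$,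 $D_{xy}\mapsto\delta_{xy}$, $E^L_{xyz}\mapsto\epsilon_y$, $E^R_{xyz}\mapsto\epsilon_{\bar y}$, applied letterwise to sequences, and put $\overline{\alpha_x}=\alpha_{\bar x}$, $\overline{\beta_{xy}}=\delta_{\bar y\bar x}$, $\overline{\delta_{xy}}=\beta_{\bar y\bar x}$, $\overline\gamma=\gamma$, $\overline{\epsilon_x}=\epsilon_{\bar x}$. Consider the cyclic orders $$O_1=\alpha_a\beta_{da}\alpha_d\beta_{Cd}\alpha_C\beta_{DC}\alpha_D\beta_{cD}\alpha_c\beta_{bc}\alpha_b\beta_{Ab}\alpha_A\beta_{BA}\alpha_B\beta_{aB},$$ $$O_2=\delta_{AD}\epsilon_A\delta_{Ba}\epsilon_B\delta_{ab}\epsilon_a\delta_{bA}\epsilon_b\delta_{CB}\epsilon_C\delta_{Dc}\epsilon_D\delta_{cd}\epsilon_c\delta_{dC}\epsilon_d .$$ For a cyclic word $\xi$ let $o_i(\xi)$ be $1$ if its letters all lie in $O_i$ and occur in the cyclic order of $O_i$ (in particular are distinct), $-1$ if they occur in the reverse cyclic order, and $0$ otherwise (only words of three or four letters are used). **The kernels.**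 For $k\ge1$ and strings $\zeta=\zeta_1\zeta_2\dots$, $\xi=\xi_1\xi_2\dots$, set $u_k(\zeta,\xi)=1$ if $\zeta_1\ne\xi_1$, $\zeta_k\ne\xi_k$, $\zeta_i=\xi_i$ for $1<i<k$, and * $k=1$: $\{\zeta_1,\xi_1\}=\{\alpha_x,\epsilon_x\}$ for some $x\in\Omega$; * $k=2$: $o_1(\bar\zeta_1\bar\xi_1\zeta_2\xi_2)=1$; * $k=3$: $o_1(\bar\zeta_1\bar\xi_1\zeta_2)=o_1(\bar\zeta_2\zeta_3\xi_3)\neq0$; * $k=4$: $o_1(\bar\zeta_1\bar\xi_1\zeta_2)=o_1(\bar\zeta_3\zeta_4\xi_4)\ne0$ or $o_2(\bar\zeta_1\bar\xi_1\zeta_4\xi_4)=1$; * $k\ge5$: $o_1(\bar\zeta_1\bar\xi_1\zeta_2)+o_2(\bar\zeta_1\bar\xi_1\zeta_4)=o_1(\bar\zeta_{k-1}\zeta_k\xi_k)+o_2(\bar\zeta_{k-3}\zeta_k\xi_k)\ne0$; and $u_k(\zeta,\xi)=0$ otherwise. Set $v_k(\zeta,\xi)=u_k(\zeta_1\cdots\zeta_k,\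 \bar\xi_k\cdots\bar\xi_1)$ and, for $x,y\in\mathbf X$, $h_k(x,y)=u_k(\phi(x),\phi(y))+v_k(\phi(x),\phi(y))$, where the strings are read from index $1$ on. The Hoeffding projections are $H_k(z)=E_\nu h_k(z,Z)$ ($Z$ distributed according to $\nu$), and $H=\sum_{k\ge1}H_k$. **Lemma.** The series $H(z)=\sum_{k\ge1}H_k(z)$ converges for every $z\in\mathbf X$, and $H$ is not cohomologous to a constant under $\tau$: there are no constant $c\in\mathbb R$ and bounded function $H_0:\mathbf X\to\mathbb R$ with $H(z)=c+H_0(\tau z)-H_0(z)$ for all $z\in\mathbf X$. -/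

import Mathlib

open MeasureTheory
open scoped ENNReal

/-- The set `Ω` of the generators `a, b, c, d` of `⟨a, b, c, d ∣ abABcdCD = 1⟩` and of their
inverses `A, B, C, D`. -/
inductive Gen
  | a | b | c | d | A | B | C | D
  deriving DecidableEq

instance : Fintype Gen :=
  ⟨{.a, .b, .c, .d, .A, .B, .C, .D}, fun x => by cases x <;> decide⟩

/-- The inverse of a generator. -/
def Gen.inv : Gen → Gen
  | .a => .A | .b => .B | .c => .C | .d => .D
  | .A => .a | .B => .b | .C => .c | .D => .d

/-- The letter after a given one in the cyclic word `abABcdCD`, i.e. the label of the next edge when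
an octagon of the Cayley graph is traversed counterclockwise. -/
def Gen.next : Gen → Gen
  | .a => .b | .b => .A | .A => .B | .B => .c
  | .c => .d | .d => .C | .C => .D | .D => .a

/-- The edges leaving a vertex of the Cayley graph are, in counterclockwise order,
`a, d, C, D, c, b, A, B`; this is the successor in that cyclic order. -/
def Gen.ccw : Gen → Gen
  | .a => .d | .d => .C | .C => .D | .D => .c
  | .c => .b | .b => .A | .A => .B | .B => .a

/-- The predecessor in the counterclockwise order of the edges leaving a vertex. -/
def Gen.cw : Gen → Gen
  | .d => .a | .C => .d | .D => .C | .c => .D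
  | .b => .c | .A => .b | .B => .A | .a => .B

/-- Left and right. -/
inductive Side
  | left | right
  deriving DecidableEq

instance : Fintype Side := ⟨{.left, .right}, fun x => by cases x <;> decide⟩

/-- The alphabet `𝔸` of the 88 Markov states. A state that comprises two or three edges is determined
by one of them:
* `B k` is `B_{jk}`, where `j` leaves the common initial vertex just to the left of `k`;
* `C k`, `Cp k`, `D k` are `C_{jk}`, `C'_{jk}`, `D_{jk}`: here `k` is the edge on the right branch
  around an octagon and `j` is the edge opposite to it on the left branch;
* `E s y` is `E^s_{xyz}`, where `y` is the middle edge.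
`A x`, `Ap s x`, `App s x` are `A_x`, `A'^s_x`, `A''^s_x`. -/
inductive State
  | A (x : Gen)
  | Ap (s : Side) (x : Gen)
  | App (s : Side) (x : Gen)
  | B (k : Gen)
  | C (k : Gen)
  | Cp (k : Gen)
  | D (k : Gen)
  | E (s : Side) (y : Gen)
  deriving DecidableEq, Fintype

instance : MeasurableSpace State := ⊤

instance : DiscreteMeasurableSpace State := ⟨fun _ => trivial⟩

/-- After the edge `x` has been traversed, the edges leaving its final vertex are met in
counterclockwise order, that is, from right to left, as `x.out 1, …, x.out 7`;
`x.out 0` leads back along `x`. -/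
def Gen.out (x : Gen) (i : ℕ) : Gen := Gen.ccw^[i] x.inv

/-- The states `A_{x.out i}` for `i = m, …, m + n - 1`. -/
def fanA (x : Gen) (m n : ℕ) : List State := (List.range n).map fun i => .A (x.out (m + i))

/-- The states `B` with right edge `x.out i` and left edge `x.out (i + 1)`, for
`i = m, …, m + n - 1`. -/
def fanB (x : Gen) (m n : ℕ) : List State := (List.range n).map fun i => .B (x.out (m + i))

open State Side in
/-- The states that may follow a given state.

After an edge of type `A` all seven edges may follow; the two extreme ones have lost a wedge on
their outer side. After `A'^L` the extreme left edge has type `A''^L`. After `A''^L` the extreme left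
edge, and the wedge next to it, are no longer available, and the next edge has type `A`. The cases
`A'^R`, `A''^R` are the mirror images. After `D_{jk}` six edges are left, between the reversed edges
`j` and `k`; the two extreme ones have type `A'`. From `B`, `C`, `C'` both branches proceed around
the octagon. At the end they meet (`D`), or the left or the right branch bifurcates (`E^L`, `E^R`)
and the two outer edges of the bifurcation start a new octagon. -/
def State.succ : State → List State
  | .A x => Ap right (x.out 1) :: Ap left (x.out 7) :: (fanA x 2 5 ++ fanB x 1 6)
  | Ap left x => Ap right (x.out 1) :: App left (x.out 7) :: (fanA x 2 5 ++ fanB x 1 6)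
  | Ap right x => App right (x.out 1) :: Ap left (x.out 7) :: (fanA x 2 5 ++ fanB x 1 6)
  | App left x => Ap right (x.out 1) :: (fanA x 2 5 ++ fanB x 1 5)
  | App right x => Ap left (x.out 7) :: (fanA x 2 5 ++ fanB x 2 5)
  | .D k => Ap right (k.out 1) :: Ap left (k.out 6) :: (fanA k 2 4 ++ fanB k 1 5)
  | .B k => [.C k.next]
  | .C k => [Cp k.next]
  | Cp k => [.D k.next, E left k.next.next.inv, E right k.next]
  | E left y => [.C y.next]
  | E right y => [.C y.cw.next]

/-- The bi-infinite sequences of states that satisfy the transition rules. -/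
def SnakeShift : Type := {x : ℤ → State // ∀ i, x (i + 1) ∈ (x i).succ}

instance : MeasurableSpace SnakeShift :=
  inferInstanceAs (MeasurableSpace {x : ℤ → State // ∀ i, x (i + 1) ∈ (x i).succ})

/-- The shift map `τ`. -/
def SnakeShift.shift (x : SnakeShift) : SnakeShift :=
  ⟨fun i => x.1 (i + 1), fun i => x.2 (i + 1)⟩

/-- The transition matrix. -/
def transition : Matrix State State ℝ := fun J K => if K ∈ J.succ then 1 else 0

/-- `lam` is an eigenvalue of the transition matrix with positive left and right eigenvectors
`u` and `v` (so that `lam` is the dominant eigenvalue), normalized by `∑ uᵢ vᵢ = 1`. -/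
structure IsPerron (lam : ℝ) (u v : State → ℝ) : Prop where
  lam_pos : 0 < lam
  u_pos : ∀ J, 0 < u J
  v_pos : ∀ J, 0 < v J
  left_eigen : Matrix.vecMul u transition = lam • u
  right_eigen : Matrix.mulVec transition v = lam • v
  normalized : ∑ J, u J * v J = 1

/-- `ν` is the Parry measure: the law of the stationary Markov chain with stationary vector
`πᵢ = uᵢ vᵢ` and transition probabilities `qᵢⱼ = aᵢⱼ vⱼ / (lam vᵢ)`. -/
def IsParryMeasure (ν : Measure SnakeShift) : Prop :=
  IsProbabilityMeasure ν ∧ ∃ (lam : ℝ) (u v : State → ℝ), IsPerron lam u v ∧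
    ∀ (m : ℤ) (n : ℕ) (w : ℕ → State),
      ν {x | ∀ i ≤ n, x.1 (m + i) = w i} =
        ENNReal.ofReal (u (w 0) * v (w 0) * ∏ i ∈ Finset.range n,
          transition (w i) (w (i + 1)) * v (w (i + 1)) / (lam * v (w i)))
/-- Law of the first `N+1` coordinates of the chain. -/
noncomputable def markovLaw {S : Type} [Fintype S] [MeasurableSpace S] (p : S → ℝ≥0∞)
    (q : S → S → ℝ≥0∞) : ℕ → Measure (ℕ → S)
  | 0 => ∑ s, p s • Measure.dirac (fun _ => s)
  | N + 1 => ∑ s, ∑ t, q s t •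
      ((markovLaw p q N).restrict {x | x N = s}).map (fun x => Function.update x (N + 1) t)

theorem markovLaw_succ_apply {S : Type} [Fintype S] [MeasurableSpace S]
    [DiscreteMeasurableSpace S] (p : S → ℝ≥0∞) (q : S → S → ℝ≥0∞) (N : ℕ) {E : Set (ℕ → S)}
    (hE : MeasurableSet E) :
    markovLaw p q (N + 1) E = ∑ s, ∑ t, q s t *
      markovLaw p q N ({x | Function.update x (N + 1) t ∈ E} ∩ {x | x N = s}) := by
  simp only [markovLaw, Measure.coe_finsetSum, Finset.sum_apply, Measure.smul_apply, smul_eq_mul]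
  refine Finset.sum_congr rfl fun s _ => Finset.sum_congr rfl fun t _ => ?_
  have hm : Measurable (fun x : ℕ → S => Function.update x (N + 1) t) := by
    refine measurable_pi_iff.2 fun i => ?_
    by_cases h : i = N + 1
    · subst h; simp
    · simpa [Function.update_of_ne h] using measurable_pi_apply i
  rw [Measure.map_apply hm hE, Measure.restrict_apply (hm hE)]
  rfl

theorem measurableSet_block {S : Type} [MeasurableSpace S] [DiscreteMeasurableSpace S]
    {I : Type} (n : ℕ) (f : ℕ → I) (w : ℕ → S) :
    MeasurableSet {x : I → S | ∀ i ≤ n, x (f i) = w i} := by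
  have : {x : I → S | ∀ i ≤ n, x (f i) = w i} =
      ⋂ i, ⋂ (_ : i ≤ n), (fun x : I → S => x (f i)) ⁻¹' {w i} := by ext; simp
  rw [this]
  exact MeasurableSet.iInter fun i => MeasurableSet.iInter fun _ =>
    measurable_pi_apply (f i) (measurableSet_singleton _)

theorem markovLaw_block {S : Type} [Fintype S] [MeasurableSpace S]
    [DiscreteMeasurableSpace S] (p : S → ℝ≥0∞) (q : S → S → ℝ≥0∞)
    (hq : ∀ s, ∑ t, q s t = 1) (hst : ∀ t, ∑ s, p s * q s t = p t) (N : ℕ) :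
    ∀ (m n : ℕ) (w : ℕ → S), m + n ≤ N →
      markovLaw p q N {x | ∀ i ≤ n, x (m + i) = w i} =
        p (w 0) * ∏ i ∈ Finset.range n, q (w i) (w (i + 1)) := by
  classical
  induction N with
  | zero =>
    intro m n w h
    obtain ⟨rfl, rfl⟩ : m = 0 ∧ n = 0 := by omega
    have hE := measurableSet_block (I := ℕ) 0 (fun i => 0 + i) w
    simp only [markovLaw, Measure.coe_finsetSum, Finset.sum_apply, Measure.smul_apply,
      smul_eq_mul, Measure.dirac_apply' _ hE]
    simp [Set.indicator_apply]
  | succ N ih =>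
    intro m n w h
    rw [markovLaw_succ_apply p q N (measurableSet_block n (fun i => m + i) w)]
    have hms : ∀ s, MeasurableSet {x : ℕ → S | x N = s} := fun s =>
      (measurable_pi_apply (X := fun _ : ℕ => S) N) (measurableSet_singleton s)
    rcases Nat.lt_or_ge (m + n) (N + 1) with h1 | h1
    · have hs : ∀ t, {x : ℕ → S | Function.update x (N + 1) t ∈
          {x : ℕ → S | ∀ i ≤ n, x (m + i) = w i}} = {x : ℕ → S | ∀ i ≤ n, x (m + i) = w i} := by
        intro t; ext x
        refine forall_congr' fun i => imp_congr_right fun hi => ?_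
        rw [Function.update_of_ne (by omega)]
      simp_rw [hs, ← Finset.sum_mul, hq, one_mul]
      rw [← ih m n w (by omega)]
      rw [← measure_biUnion_finset (f := fun s => {x : ℕ → S | ∀ i ≤ n, x (m + i) = w i} ∩
        {x : ℕ → S | x N = s})]
      · congr 1; ext x; simp
      · intro s _ s' _ hss
        refine Set.disjoint_left.2 fun x hx hx' => hss (hx.2.symm.trans hx'.2)
      · intro s _
        exact (measurableSet_block n (fun i => m + i) w).inter (hms s)
    · have h2 : m + n = N + 1 := by omega
      rcases n with _ | n
      · have hs : ∀ t s, {x : ℕ → S | Function.update x (N + 1) t ∈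
          {x : ℕ → S | ∀ i ≤ 0, x (m + i) = w i}} ∩ {x | x N = s} =
            if t = w 0 then {x | ∀ i ≤ 0, x (N + i) = (fun _ => s) i} else ∅ := by
          intro t s; ext x
          have : m = N + 1 := by omega
          subst this
          by_cases ht : t = w 0 <;> simp [ht]
        have key : ∀ s t, q s t * markovLaw p q N ({x : ℕ → S | Function.update x (N + 1) t ∈
          {x : ℕ → S | ∀ i ≤ 0, x (m + i) = w i}} ∩ {x | x N = s}) =
            if t = w 0 then p s * q s (w 0) else 0 := by
          intro s t
          rw [hs]
          split_ifs with ht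
          · rw [ih N 0 (fun _ => s) (by omega), ht]; simp [mul_comm]
          · simp
        refine (Finset.sum_congr rfl fun s _ => Finset.sum_congr rfl fun t _ => key s t).trans ?_
        simp [hst]
      · have hmn : m + n = N := by omega
        have key : ∀ s t, q s t * markovLaw p q N ({x : ℕ → S | Function.update x (N + 1) t ∈
          {x : ℕ → S | ∀ i ≤ n + 1, x (m + i) = w i}} ∩ {x | x N = s}) =
            if s = w n then (if t = w (n + 1) then q (w n) (w (n + 1)) *
              (p (w 0) * ∏ i ∈ Finset.range n, q (w i) (w (i + 1))) else 0) else 0 := by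
          intro s t
          by_cases hs : s = w n
          · by_cases ht : t = w (n + 1)
            · rw [if_pos hs, if_pos ht, ← ih m n w (by omega), hs, ht]
              congr 2
              ext x
              simp only [Set.mem_inter_iff, Set.mem_ofPred_eq]
              constructor
              · rintro ⟨h3, -⟩ i hi
                have := h3 i (by omega)
                rwa [Function.update_of_ne (by omega)] at this
              · intro h3
                refine ⟨fun i hi => ?_, hmn ▸ h3 n le_rfl⟩
                rcases Nat.lt_or_ge i (n + 1) with h4 | h4
                · rw [Function.update_of_ne (by omega)]; exact h3 i (by omega)
                · obtain rfl : i = n + 1 := by omega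
                  rw [h2, Function.update_self]
            · rw [if_pos hs, if_neg ht]
              convert mul_zero _
              convert measure_empty (μ := markovLaw p q N)
              ext x
              simp only [Set.mem_inter_iff, Set.mem_ofPred_eq, Set.mem_empty_iff_false, iff_false]
              rintro ⟨h3, -⟩
              have := h3 (n + 1) le_rfl
              rw [h2, Function.update_self] at this
              exact ht this
          · rw [if_neg hs]
            convert mul_zero _
            convert measure_empty (μ := markovLaw p q N)
            ext x
            simp only [Set.mem_inter_iff, Set.mem_ofPred_eq, Set.mem_empty_iff_false, iff_false]
            rintro ⟨h3, h4⟩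
            have := h3 n (by omega)
            rw [Function.update_of_ne (by omega), hmn, h4] at this
            exact hs this
        refine (Finset.sum_congr rfl fun s _ => Finset.sum_congr rfl fun t _ => key s t).trans ?_
        rw [Finset.prod_range_succ]
        simp only [Finset.sum_const_zero, Finset.sum_ite_irrel, Finset.sum_ite_eq', Finset.mem_univ, if_true]
        ring

theorem exists_twoSided_markov {S : Type} [Fintype S] [MeasurableSpace S]
    [DiscreteMeasurableSpace S] (p : S → ℝ≥0∞) (q : S → S → ℝ≥0∞) (hp : ∑ s, p s = 1)
    (hq : ∀ s, ∑ t, q s t = 1) (hst : ∀ t, ∑ s, p s * q s t = p t) :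
    ∃ μ : Measure (ℤ → S), IsProbabilityMeasure μ ∧ ∀ (m : ℤ) (n : ℕ) (w : ℕ → S),
      μ {x | ∀ i ≤ n, x (m + i) = w i} =
        p (w 0) * ∏ i ∈ Finset.range n, q (w i) (w (i + 1)) := by
  classical
  let _ : TopologicalSpace S := ⊥
  have : DiscreteTopology S := ⟨rfl⟩
  have : BorelSpace S := ⟨by
    ext s; rw [borel_eq_top_of_discrete]; simp [MeasurableSet.of_discrete]⟩
  have hprob : ∀ N, IsProbabilityMeasure (markovLaw p q N) := by
    intro N
    constructor
    have h0 : (Set.univ : Set (ℕ → S)) =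
        ⋃ s ∈ (Finset.univ : Finset S), {x | ∀ i ≤ 0, x (0 + i) = (fun _ => s) i} := by
      ext x; simp
    rw [h0, measure_biUnion_finset]
    · simp_rw [markovLaw_block p q hq hst N 0 0 _ (Nat.zero_le _)]
      simpa using hp
    · intro s _ s' _ hss
      refine Set.disjoint_left.2 fun x hx hx' => hss ?_
      have h1 := hx 0 le_rfl
      have h2 := hx' 0 le_rfl
      exact h1.symm.trans h2
    · exact fun s _ => measurableSet_block 0 (fun i => 0 + i) (fun _ => s)
  have hmeas : ∀ N : ℕ, Measurable (fun (x : ℕ → S) (i : ℤ) => x (i + N).toNat) := fun N =>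
    measurable_pi_iff.2 fun i => measurable_pi_apply _
  let B : ℕ → ProbabilityMeasure (ℤ → S) := fun N =>
    ⟨(markovLaw p q (2 * N)).map (fun x i => x (i + N).toNat),
      haveI := hprob (2 * N); Measure.isProbabilityMeasure_map (hmeas N).aemeasurable⟩
  let F : Ultrafilter (ProbabilityMeasure (ℤ → S)) := Ultrafilter.map B (Filter.hyperfilter ℕ)
  have : Nonempty (ProbabilityMeasure (ℤ → S)) := ⟨B 0⟩
  have hF : Filter.Tendsto B (Filter.hyperfilter ℕ) (nhds F.lim) := F.le_nhds_lim
  refine ⟨(F.lim : Measure (ℤ → S)), inferInstance, fun m n w => ?_⟩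
  have hcl : IsClopen {x : ℤ → S | ∀ i ≤ n, x (m + i) = w i} := by
    have : {x : ℤ → S | ∀ i ≤ n, x (m + i) = w i} =
        ⋂ i ∈ Finset.range (n + 1), (fun x : ℤ → S => x (m + i)) ⁻¹' {w i} := by
      ext; simp
    rw [this]
    exact isClopen_biInter_finset fun i _ => (isClopen_discrete _).preimage (continuous_apply _)
  have ht := ProbabilityMeasure.tendsto_measure_of_null_frontier_of_tendsto' hF
    (E := {x : ℤ → S | ∀ i ≤ n, x (m + i) = w i}) (by rw [hcl.frontier_eq]; simp)
  refine tendsto_nhds_unique ht (Filter.Tendsto.congr' ?_ tendsto_const_nhds)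
  have hev : ∀ᶠ N : ℕ in (Filter.hyperfilter ℕ : Filter ℕ), m.natAbs + n ≤ N :=
    Filter.Eventually.filter_mono (Nat.hyperfilter_le_atTop)
      (Filter.eventually_ge_atTop (m.natAbs + n))
  filter_upwards [hev] with N hN
  change _ = (markovLaw p q (2 * N)).map (fun (x : ℕ → S) (i : ℤ) => x (i + N).toNat) _
  rw [Measure.map_apply (hmeas N) (measurableSet_block n (fun i => m + (i : ℤ)) w)]
  rw [← markovLaw_block p q hq hst (2 * N) (m + N).toNat n w (by omega)]
  congr 1
  ext x
  refine forall_congr' fun i => imp_congr_right fun hi => ?_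
  change _ ↔ x (m + (i : ℤ) + N).toNat = w i
  rw [show (m + (i : ℤ) + N).toNat = (m + N).toNat + i by omega]

/-! ### Existence of the Parry measure -/

/-- The type of a state: `0, …, 7` stand for `A, A', A'', B, C, C', D, E`. -/
def State.ty : State → Fin 8
  | .A _ => 0 | .Ap _ _ => 1 | .App _ _ => 2 | .B _ => 3
  | .C _ => 4 | .Cp _ => 5 | .D _ => 6 | .E _ _ => 7

/-- A list of all states. -/
def State.all : List State :=
  [Gen.a, .b, .c, .d, .A, .B, .C, .D].flatMap fun x => [.A x, .Ap .left x, .Ap .right x,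
    .App .left x, .App .right x, .B x, .C x, .Cp x, .D x, .E .left x, .E .right x]

theorem State.mem_all (J : State) : J ∈ State.all := by
  revert J; decide

theorem State.nodup_all : State.all.Nodup := by
  decide +kernel

/-- The number of states of type `t` that may precede a state of type `s`. -/
def tyPred : Fin 8 → Fin 8 → ℕ :=
  ![![5, 10, 10, 0, 0, 0, 4, 0], ![1, 1, 1, 0, 0, 0, 1, 0], ![0, 1, 0, 0, 0, 0, 0, 0],
    ![6, 12, 10, 0, 0, 0, 5, 0], ![0, 0, 0, 1, 0, 0, 0, 2], ![0, 0, 0, 0, 1, 0, 0, 0],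
    ![0, 0, 0, 0, 0, 1, 0, 0], ![0, 0, 0, 0, 0, 1, 0, 0]]

/-- The number of states of type `t` that may follow a state of type `s`. -/
def tySucc : Fin 8 → Fin 8 → ℕ :=
  ![![5, 2, 0, 6, 0, 0, 0, 0], ![5, 1, 1, 6, 0, 0, 0, 0], ![5, 1, 0, 5, 0, 0, 0, 0],
    ![0, 0, 0, 0, 1, 0, 0, 0], ![0, 0, 0, 0, 0, 1, 0, 0], ![0, 0, 0, 0, 0, 0, 1, 2],
    ![4, 2, 0, 5, 0, 0, 0, 0], ![0, 0, 0, 0, 1, 0, 0, 0]]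

theorem State.count_pred : ∀ K ∈ State.all, ∀ t : Fin 8,
    ((State.all.filter fun J => K ∈ J.succ).map State.ty).count t = tyPred K.ty t := by
  decide +kernel

theorem State.count_succ : ∀ J ∈ State.all, ∀ t : Fin 8,
    ((State.all.filter fun K => K ∈ J.succ).map State.ty).count t = tySucc J.ty t := by
  decide +kernel

theorem sum_ty_list (f : Fin 8 → ℝ) (P : State → Prop) [DecidablePred P] :
    ∑ J, (if P J then f J.ty else 0) =
      ∑ t, (((State.all.filter fun J => P J).map State.ty).count t : ℝ) * f t := by
  have h1 : (Finset.univ : Finset State) = State.all.toFinset := by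
    ext J; simp [State.mem_all]
  rw [h1, List.sum_toFinset _ State.nodup_all]
  induction State.all with
  | nil => simp
  | cons J l ih =>
    rw [List.map_cons, List.sum_cons, ih]
    by_cases hJ : P J
    · simp [hJ, List.count_cons, add_mul, Finset.sum_add_distrib, add_comm]
    · simp [hJ]

theorem exists_isPerron : ∃ (lam : ℝ) (u v : State → ℝ), IsPerron lam u v := by
  obtain ⟨l, ⟨hl6, -⟩, hl⟩ : ∃ l ∈ Set.Icc (6 : ℝ) 7, l ^ 4 - 6 * l ^ 3 - 6 * l ^ 2 - 6 * l + 1 = 0 := by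
    have := intermediate_value_Icc (show (6 : ℝ) ≤ 7 by norm_num)
      (f := fun l : ℝ => l ^ 4 - 6 * l ^ 3 - 6 * l ^ 2 - 6 * l + 1) (by fun_prop)
    exact this ⟨by norm_num, by norm_num⟩
  have h4 : l ^ 4 = 6 * l ^ 3 + 6 * l ^ 2 + 6 * l - 1 := by linarith
  have h2 : 6 * l ≤ l ^ 2 := by nlinarith
  have h3 : 6 * l ^ 2 ≤ l ^ 3 := by nlinarith [sq_nonneg l]
  let f : Fin 8 → ℝ := ![l ^ 3 - l ^ 2 - l - 1, l ^ 2, l, l ^ 3 - 2, l ^ 2, l, 1, 1]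
  let g : Fin 8 → ℝ := ![l ^ 3 + l ^ 2 + l - 1, l ^ 3 + l ^ 2 - 1, l ^ 3 - 1, 1, l, l ^ 2, l ^ 3 - 2, 1]
  have hf : ∀ t, 0 < f t := by
    intro t; fin_cases t <;> simp [f] <;> nlinarith
  have hg : ∀ t, 0 < g t := by
    intro t; fin_cases t <;> simp [g] <;> nlinarith
  have hfl : ∀ s, ∑ t, (tyPred s t : ℝ) * f t = l * f s := by
    intro s
    fin_cases s <;> simp [Fin.sum_univ_eight, tyPred, f] <;> ring_nf <;> (try rw [h4]) <;> ring
  have hgl : ∀ s, ∑ t, (tySucc s t : ℝ) * g t = l * g s := by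
    intro s
    fin_cases s <;> simp [Fin.sum_univ_eight, tySucc, g] <;> ring_nf <;> (try rw [h4]) <;> ring
  set Z : ℝ := ∑ J : State, f J.ty * g J.ty with hZ
  have hZpos : 0 < Z := Finset.sum_pos (fun J _ => mul_pos (hf _) (hg _)) ⟨.A .a, Finset.mem_univ _⟩
  refine ⟨l, fun J => f J.ty / Z, fun J => g J.ty, by linarith, fun J => div_pos (hf _) hZpos,
    fun J => hg _, ?_, ?_, ?_⟩
  · ext K
    have := sum_ty_list f (fun J => K ∈ J.succ)
    simp_rw [State.count_pred K (State.mem_all K), hfl] at this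
    simp only [Matrix.vecMul, dotProduct, transition, Pi.smul_apply, smul_eq_mul]
    rw [← mul_div_assoc, ← this, Finset.sum_div]
    refine Finset.sum_congr rfl fun J _ => ?_
    split_ifs <;> simp
  · ext J
    have := sum_ty_list g (fun K => K ∈ J.succ)
    simp_rw [State.count_succ J (State.mem_all J), hgl] at this
    simp only [Matrix.mulVec, dotProduct, transition, Pi.smul_apply, smul_eq_mul]
    rw [← this]
    refine Finset.sum_congr rfl fun K _ => ?_
    split_ifs <;> simp
  · simp_rw [div_mul_eq_mul_div]
    rw [← Finset.sum_div, ← hZ, div_self hZpos.ne']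

theorem exists_isParryMeasure : ∃ ν : Measure SnakeShift, IsParryMeasure ν := by
  obtain ⟨lam, u, v, h⟩ := exists_isPerron
  have hq0 : ∀ J K, 0 ≤ transition J K * v K / (lam * v J) := fun J K =>
    div_nonneg (mul_nonneg (by unfold transition; split_ifs <;> norm_num) (h.v_pos K).le)
      (mul_pos h.lam_pos (h.v_pos J)).le
  have hp0 : ∀ J, 0 ≤ u J * v J := fun J => (mul_pos (h.u_pos J) (h.v_pos J)).le
  obtain ⟨μ, hμ, hμb⟩ := exists_twoSided_markov (fun J => ENNReal.ofReal (u J * v J))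
    (fun J K => ENNReal.ofReal (transition J K * v K / (lam * v J)))
    (by rw [← ENNReal.ofReal_sum_of_nonneg fun J _ => hp0 J, h.normalized, ENNReal.ofReal_one])
    (fun J => by
      rw [← ENNReal.ofReal_sum_of_nonneg fun K _ => hq0 J K, ← Finset.sum_div]
      have := congrFun h.right_eigen J
      simp only [Matrix.mulVec, dotProduct, Pi.smul_apply, smul_eq_mul] at this
      rw [this, div_self (mul_pos h.lam_pos (h.v_pos J)).ne', ENNReal.ofReal_one])
    (fun K => by
      simp_rw [← ENNReal.ofReal_mul (hp0 _)]
      rw [← ENNReal.ofReal_sum_of_nonneg fun J _ => mul_nonneg (hp0 J) (hq0 J K)]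
      congr 1
      have := congrFun h.left_eigen K
      simp only [Matrix.vecMul, dotProduct, Pi.smul_apply, smul_eq_mul] at this
      have h2 : ∀ J, u J * v J * (transition J K * v K / (lam * v J)) =
          u J * transition J K * (v K / lam) := fun J => by
        have := (h.v_pos J).ne'
        have := h.lam_pos.ne'
        field_simp
      simp_rw [h2]
      rw [← Finset.sum_mul, this]
      have := h.lam_pos.ne'
      field_simp)
  have hsub : ∀ᵐ x ∂μ, ∀ i, x (i + 1) ∈ (x i).succ := by
    rw [ae_all_iff]
    intro i
    rw [ae_iff]
    refine measure_mono_null (t := ⋃ p : {p : State × State // p.2 ∉ p.1.succ},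
      {x | ∀ j ≤ 1, x (i + (j : ℕ)) = (fun j : ℕ => if j = 0 then p.1.1 else p.1.2) j}) ?_ ?_
    · intro x hx
      refine Set.mem_iUnion.2 ⟨⟨(x i, x (i + 1)), hx⟩, fun j hj => ?_⟩
      interval_cases j <;> simp
    · refine measure_iUnion_null fun p => ?_
      rw [hμb i 1]
      simp [transition, p.2]
  have hms : MeasurableSet {x : ℤ → State | ∀ i, x (i + 1) ∈ (x i).succ} := by
    have : {x : ℤ → State | ∀ i, x (i + 1) ∈ (x i).succ} =
        ⋂ i, (fun x : ℤ → State => (x i, x (i + 1))) ⁻¹' {p | p.2 ∈ p.1.succ} := by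
      ext; simp
    rw [this]
    exact MeasurableSet.iInter fun i =>
      ((measurable_pi_apply i).prodMk (measurable_pi_apply (i + 1))) (MeasurableSet.of_discrete)
  have hval : ∀ E : Set (ℤ → State), MeasurableSet E →
      Measure.comap (fun x : SnakeShift => x.1) μ {x | x.1 ∈ E} = μ E := by
    intro E hE
    have hcomap : Measure.comap (fun x : SnakeShift => x.1) μ {x | x.1 ∈ E} =
        μ ((fun x : SnakeShift => x.1) '' {x | x.1 ∈ E}) := by
      refine Measure.comap_apply _ Subtype.val_injective (fun s hs => ?_) _ ?_
      · exact MeasurableSet.subtype_image hms hs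
      · exact measurable_subtype_coe hE
    rw [hcomap]
    refine measure_congr ?_
    filter_upwards [hsub] with x hx
    refine propext ⟨?_, fun hxE => ⟨⟨x, hx⟩, hxE, rfl⟩⟩
    rintro ⟨y, hy, rfl⟩
    exact hy
  refine ⟨Measure.comap (fun x : SnakeShift => x.1) μ, ⟨?_⟩, lam, u, v, h, fun m n w => ?_⟩
  · have := hval Set.univ MeasurableSet.univ
    simpa using this
  · refine (hval _ (measurableSet_block n (fun i => m + (i : ℤ)) w)).trans ?_
    rw [hμb, ENNReal.ofReal_mul (hp0 _), ENNReal.ofReal_prod_of_nonneg fun i _ => hq0 _ _]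

/-- The Parry measure `ν`. -/
noncomputable def parryMeasure : Measure SnakeShift := exists_isParryMeasure.choose

theorem isParryMeasure_parryMeasure : IsParryMeasure parryMeasure :=
  exists_isParryMeasure.choose_spec

/-! ### Spines and the kernels `h_k` -/

/-- The alphabet `Φ` of the spine letters. Only the eight letters `be j k` with `j = k.ccw`, and
their inverses `de`, occur in spines. -/
inductive Spine
  | al (x : Gen)
  | be (j k : Gen)
  | ga
  | de (j k : Gen)
  | ep (x : Gen)
  deriving DecidableEq

/-- The inverse of a spine letter (the same edge traversed in the opposite direction). -/
def Spine.bar : Spine → Spine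
  | al x => al x.inv
  | be j k => de k.inv j.inv
  | ga => ga
  | de j k => be k.inv j.inv
  | ep x => ep x.inv

/-- The map `φ` from Markov states to spine letters. In `B_{jk}` the left edge is `j = k.ccw`; in
`D_{jk}` the left edge is `j = k.next.inv`. -/
def State.spine : State → Spine
  | .A x => .al x
  | .Ap _ x => .al x
  | .App _ x => .al x
  | .B k => .be k.ccw k
  | .C _ => .ga
  | .Cp _ => .ga
  | .D k => .de k.next.inv k
  | .E .left y => .ep y
  | .E .right y => .ep y.inv

open Gen Spine in
/-- The cyclic counterclockwise order of the edges of the spine graph at a vertex of the Cayley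
graph. -/
def order₁ : List Spine :=
  [al a, be d a, al d, be C d, al C, be D C, al D, be c D,
   al c, be b c, al b, be A b, al A, be B A, al B, be a B]

open Gen Spine in
/-- The cyclic counterclockwise order of the edges of the spine graph at the centre of an octagon
of the Cayley graph. -/
def order₂ : List Spine :=
  [de A D, ep A, de B a, ep B, de a b, ep a, de b A, ep b,
   de C B, ep C, de D c, ep D, de c d, ep c, de d C, ep d]

/-- The orientation `o(w)` of a cyclic word `w` with respect to a cyclically ordered set `O`: it is
`1` if the letters of `w` belong to `O` and occur there in cyclic order, `-1` if they occur in
reverse cyclic order, and `0` otherwise. -/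
def orientation (O w : List Spine) : ℤ :=
  if ∃ r ∈ O.cyclicPermutations, w.Sublist r then 1
  else if ∃ r ∈ O.reverse.cyclicPermutations, w.Sublist r then -1
  else 0

/-- The orientation `o₁`. -/
def o₁ (w : List Spine) : ℤ := orientation order₁ w

/-- The orientation `o₂`. -/
def o₂ (w : List Spine) : ℤ := orientation order₂ w

open Spine in
/-- The case distinction on `k` in the definition of `u_k(ζ, ξ)`. -/
def IsLinked (ζ ξ : ℕ → Spine) : ℕ → Prop
  | 0 => False
  | 1 => ∃ x, (ζ 1 = al x ∧ ξ 1 = ep x) ∨ (ζ 1 = ep x ∧ ξ 1 = al x)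
  | 2 => o₁ [(ζ 1).bar, (ξ 1).bar, ζ 2, ξ 2] = 1
  | 3 => o₁ [(ζ 1).bar, (ξ 1).bar, ζ 2] = o₁ [(ζ 2).bar, ζ 3, ξ 3] ∧
      o₁ [(ζ 2).bar, ζ 3, ξ 3] ≠ 0
  | 4 => (o₁ [(ζ 1).bar, (ξ 1).bar, ζ 2] = o₁ [(ζ 3).bar, ζ 4, ξ 4] ∧
      o₁ [(ζ 3).bar, ζ 4, ξ 4] ≠ 0) ∨ o₂ [(ζ 1).bar, (ξ 1).bar, ζ 4, ξ 4] = 1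
  | k => o₁ [(ζ 1).bar, (ξ 1).bar, ζ 2] + o₂ [(ζ 1).bar, (ξ 1).bar, ζ 4] =
        o₁ [(ζ (k - 1)).bar, ζ k, ξ k] + o₂ [(ζ (k - 3)).bar, ζ k, ξ k] ∧
      o₁ [(ζ (k - 1)).bar, ζ k, ξ k] + o₂ [(ζ (k - 3)).bar, ζ k, ξ k] ≠ 0

open Classical in
/-- The function `u_k(ζ, ξ)` of the strings `ζ 1, ζ 2, …` and `ξ 1, ξ 2, …`. -/
noncomputable def uKernel (k : ℕ) (ζ ξ : ℕ → Spine) : ℕ :=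
  if ζ 1 ≠ ξ 1 ∧ ζ k ≠ ξ k ∧ (∀ i, 1 < i → i < k → ζ i = ξ i) ∧ IsLinked ζ ξ k then 1 else 0

/-- The function `v_k(ζ, ξ) = u_k(ζ 1 ⋯ ζ k, (ξ k)⁻¹ ⋯ (ξ 1)⁻¹)`. -/
noncomputable def vKernel (k : ℕ) (ζ ξ : ℕ → Spine) : ℕ :=
  uKernel k ζ fun i => (ξ (k + 1 - i)).bar

/-- The spine of `x`, read from time `1` on. -/
def SnakeShift.spine (x : SnakeShift) (i : ℕ) : Spine := (x.1 i).spine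

/-- The kernel `h_k`. -/
noncomputable def hKernel (k : ℕ) (x y : SnakeShift) : ℝ :=
  uKernel k x.spine y.spine + vKernel k x.spine y.spine

/-- The Hoeffding projection `H_k(z) = E_ν h_k(z, Z)`. -/
noncomputable def hoeffding (k : ℕ) (z : SnakeShift) : ℝ :=
  ∫ Z, hKernel k z Z ∂parryMeasure

/-- `H = ∑_{k ≥ 1} H_k`. -/
noncomputable def totalHoeffding (z : SnakeShift) : ℝ := ∑' k : ℕ, hoeffding (k + 1) z

/-- `F` is cohomologous to a constant under `T`: `F = c + H₀ ∘ T - H₀` for a constant `c` and a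
bounded function `H₀`. -/
def IsCohomologousToConst {X : Type*} (T : X → X) (F : X → ℝ) : Prop :=
  ∃ (c : ℝ) (H₀ : X → ℝ), (∃ M, ∀ z, |H₀ z| ≤ M) ∧ ∀ z, F z = c + H₀ (T z) - H₀ z

/-! If `H` were a constant `c` plus a coboundary, the transfer function would cancel along every
periodic orbit, so the average of `H` over each of them would be `c`. It therefore suffices to find
two periodic orbits with different averages.

On the fixed point `axisPoint` all `H_k` are nonnegative, so `c ≥ H_2`. `H_2` is large there because
the straight path through a vertex is crossed by many two-step paths: ten cylinders of equal mass
already give the lower bound `le_hoeffding_two_axisPoint`.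

The second orbit, `octagonCycle`, has period 6 and only ever sees letters interior to octagons. At
four of its points the first spine letter is `γ`, which lies in neither cyclic order, so nothing is
linked and `H = 0` (`totalHoeffding_eq_zero`). At the other two the first letter is some `ε_y`;
there `H_2 = 0`, only two letters contribute to `H_1`, and the remaining terms are dominated by a
geometric series with small coefficients (`totalHoeffding_le`). With `Λ` between 6.9 and 7 the
resulting upper bound for the sum over this orbit is smaller than six times the lower bound for `c`
(`weights_lt`).

Two ingredients make the estimates explicit. The Perron data are unique up to scaling, hence equal
to polynomials in `Λ` depending only on the type of a state (`IsPerron.eq_weights`). A spine word is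
lifted to states in at most one way from each initial state, so prescribing `n + 1` consecutive
letters costs a factor `Λ⁻ⁿ` (`parryMeasure_spine_le`). Since `h_k` forces agreement of `k - 2`
letters, the latter also yields convergence of the series. -/

/-! ### Irreducibility and the explicit Perron data -/

/-- A positive eigenvector of an irreducible nonnegative matrix is unique up to scaling. -/
theorem exists_pos_smul_of_irreducible {S : Type*} [Fintype S] [Nonempty S] (T : Matrix S S ℝ)
    (hT : ∀ i j, 0 ≤ T i j)
    (hirr : ∀ i j, Relation.ReflTransGen (fun i j => 0 < T i j) i j) (l : ℝ) (v g : S → ℝ)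
    (hv : ∀ i, 0 < v i) (hg : ∀ i, 0 < g i) (hTv : T.mulVec v = l • v) (hTg : T.mulVec g = l • g) :
    ∃ c, 0 < c ∧ ∀ i, v i = c * g i := by
  -- For the minimal ratio `c`, the vector `v - c g` is a nonnegative eigenvector with a zero at
  -- `k`; the eigenvector equation spreads this zero along positive entries, hence everywhere.
  obtain ⟨k, hk⟩ := Finite.exists_min (fun i => v i / g i)
  set c := v k / g k
  have hw : ∀ i, 0 ≤ v i - c * g i := fun i => by
    have := (le_div_iff₀ (hg i)).1 (hk i)
    linarith
  have heig : ∀ i, ∑ j, T i j * (v j - c * g j) = l * (v i - c * g i) := fun i => by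
    have h1 := congrFun hTv i
    have h2 := congrFun hTg i
    simp only [Matrix.mulVec, dotProduct, Pi.smul_apply, smul_eq_mul] at h1 h2
    simp_rw [mul_sub, Finset.sum_sub_distrib, h1, mul_left_comm _ c, ← Finset.mul_sum, h2]
  refine ⟨c, div_pos (hv k) (hg k), fun i => ?_⟩
  have hzero : v i - c * g i = 0 := by
    induction hirr k i with
    | refl => simp [c, (hg k).ne']
    | @tail a b _ hab ih =>
      have h := heig a
      rw [ih, mul_zero, Finset.sum_eq_zero_iff_of_nonneg
        (fun j _ => mul_nonneg (hT a j) (hw j))] at h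
      exact (mul_eq_zero.1 (h b (Finset.mem_univ b))).resolve_left hab.ne'
  linarith

/-- The states that can be reached from the states in `L` in at most `n` steps. -/
def State.reach : ℕ → List State → List State
  | 0, L => L
  | n + 1, L => State.reach n (L ++ L.flatMap State.succ).dedup

theorem State.reflTransGen_of_mem_reach (n : ℕ) (L : List State) (K : State)
    (hK : K ∈ State.reach n L) :
    ∃ J ∈ L, Relation.ReflTransGen (fun J K : State => K ∈ J.succ) J K := by
  induction n generalizing L with
  | zero => exact ⟨K, hK, .refl⟩
  | succ n ih =>
    obtain ⟨J, hJ, h⟩ := ih _ hK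
    rw [List.mem_dedup, List.mem_append, List.mem_flatMap] at hJ
    rcases hJ with hJ | ⟨I, hI, hJ⟩
    · exact ⟨J, hJ, h⟩
    · exact ⟨I, hI, .head hJ h⟩

theorem State.mem_reach_A : ∀ K ∈ State.all, K ∈ State.reach 6 [.A .a] := by
  decide +kernel

theorem Gen.mem_reach_A : ∀ x : Gen, State.A .a ∈ State.reach 2 [.A x] := by
  decide +kernel

theorem State.exists_A_reachable (J : State) :
    ∃ x, Relation.ReflTransGen (fun J K : State => K ∈ J.succ) J (.A x) := by
  have hD : ∀ k, ∃ x, State.A x ∈ (State.D k).succ := by decide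
  have hC : ∀ k, State.D k.next.next ∈ State.reach 2 [.C k] := by decide
  have hC' : ∀ k, ∃ x, Relation.ReflTransGen (fun J K : State => K ∈ J.succ) (.C k)
      (.A x) := by
    intro k
    obtain ⟨J, hJ, h⟩ := State.reflTransGen_of_mem_reach _ _ _ (hC k)
    rw [List.mem_singleton] at hJ
    subst hJ
    exact (hD k.next.next).imp fun x hx => h.tail hx
  cases J with
  | A x => exact ⟨x, .refl⟩
  | Ap s x => exact ⟨x.out 2, .single (by cases s <;> simp [State.succ, fanA, List.range_succ])⟩
  | App s x => exact ⟨x.out 2, .single (by cases s <;> simp [State.succ, fanA, List.range_succ])⟩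
  | B k => exact (hC' k.next).imp fun x hx => .head (by simp [State.succ]) hx
  | C k => exact hC' k
  | Cp k =>
    obtain ⟨x, hx⟩ := hD k.next
    exact ⟨x, .head (b := .D k.next) (by simp [State.succ]) (.single hx)⟩
  | D k => exact (hD k).imp fun x hx => .single hx
  | E s y =>
    cases s
    · exact (hC' y.next).imp fun x hx => .head (by simp [State.succ]) hx
    · exact (hC' y.cw.next).imp fun x hx => .head (by simp [State.succ]) hx

/-- The route passes through `A_a`: from any state to some `A_x`, then to `A_a`, then to the target.
Only the last two legs need a search, which keeps the finite check small. -/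
theorem State.reflTransGen_succ (J K : State) :
    Relation.ReflTransGen (fun J K : State => K ∈ J.succ) J K := by
  obtain ⟨x, hx⟩ := J.exists_A_reachable
  obtain ⟨_, h1, h2⟩ := State.reflTransGen_of_mem_reach _ _ _ (Gen.mem_reach_A x)
  obtain ⟨_, h3, h4⟩ := State.reflTransGen_of_mem_reach _ _ _ (State.mem_reach_A K K.mem_all)
  rw [List.mem_singleton] at h1 h3
  subst h1 h3
  exact (hx.trans h2).trans h4

theorem transition_nonneg (J K : State) : 0 ≤ transition J K := by
  unfold transition; split_ifs <;> norm_num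

theorem transition_pos_iff (J K : State) : 0 < transition J K ↔ K ∈ J.succ := by
  unfold transition; split_ifs with h <;> simp [h]

/-- The entries of the left Perron eigenvector on the eight types of states. -/
def leftWeight (l : ℝ) : Fin 8 → ℝ :=
  ![l ^ 3 - l ^ 2 - l - 1, l ^ 2, l, l ^ 3 - 2, l ^ 2, l, 1, 1]

/-- The entries of the right Perron eigenvector on the eight types of states. -/
def rightWeight (l : ℝ) : Fin 8 → ℝ :=
  ![l ^ 3 + l ^ 2 + l - 1, l ^ 3 + l ^ 2 - 1, l ^ 3 - 1, 1, l, l ^ 2, l ^ 3 - 2, 1]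

/-- The sum of the products of the left and right weights of all states. -/
noncomputable def totalWeight (l : ℝ) : ℝ :=
  ∑ J : State, leftWeight l J.ty * rightWeight l J.ty

theorem leftWeight_pos {l : ℝ} (hl : 6 ≤ l) (t : Fin 8) : 0 < leftWeight l t := by
  have h2 : 6 * l ≤ l ^ 2 := by nlinarith
  have h3 : 6 * l ^ 2 ≤ l ^ 3 := by nlinarith [sq_nonneg l]
  fin_cases t <;> simp [leftWeight] <;> nlinarith

theorem rightWeight_pos {l : ℝ} (hl : 6 ≤ l) (t : Fin 8) : 0 < rightWeight l t := by
  have h2 : 6 * l ≤ l ^ 2 := by nlinarith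
  have h3 : 6 * l ^ 2 ≤ l ^ 3 := by nlinarith [sq_nonneg l]
  fin_cases t <;> simp [rightWeight] <;> nlinarith

/-- The number of predecessors of each type depends only on the type of the state, so the 88
equations collapse to eight, which follow from the quartic. -/
theorem vecMul_leftWeight {l : ℝ} (h4 : l ^ 4 = 6 * l ^ 3 + 6 * l ^ 2 + 6 * l - 1) :
    Matrix.vecMul (fun J => leftWeight l J.ty) transition = l • fun J => leftWeight l J.ty := by
  have hfl : ∀ s, ∑ t, (tyPred s t : ℝ) * leftWeight l t = l * leftWeight l s := by
    intro s
    fin_cases s <;> simp [Fin.sum_univ_eight, tyPred, leftWeight] <;> ring_nf <;>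
      (try rw [h4]) <;> ring
  ext K
  have := sum_ty_list (leftWeight l) (fun J => K ∈ J.succ)
  simp_rw [State.count_pred K (State.mem_all K), hfl] at this
  simp only [Matrix.vecMul, dotProduct, transition, Pi.smul_apply, smul_eq_mul]
  rw [← this]
  refine Finset.sum_congr rfl fun J _ => ?_
  split_ifs <;> simp

theorem mulVec_rightWeight {l : ℝ} (h4 : l ^ 4 = 6 * l ^ 3 + 6 * l ^ 2 + 6 * l - 1) :
    Matrix.mulVec transition (fun J => rightWeight l J.ty) = l • fun J => rightWeight l J.ty := by
  have hgl : ∀ s, ∑ t, (tySucc s t : ℝ) * rightWeight l t = l * rightWeight l s := by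
    intro s
    fin_cases s <;> simp [Fin.sum_univ_eight, tySucc, rightWeight] <;> ring_nf <;>
      (try rw [h4]) <;> ring
  ext J
  have := sum_ty_list (rightWeight l) (fun K => K ∈ J.succ)
  simp_rw [State.count_succ J (State.mem_all J), hgl] at this
  simp only [Matrix.mulVec, dotProduct, transition, Pi.smul_apply, smul_eq_mul]
  rw [← this]
  refine Finset.sum_congr rfl fun K _ => ?_
  split_ifs <;> simp

theorem totalWeight_pos {l : ℝ} (hl : 6 ≤ l) : 0 < totalWeight l :=
  Finset.sum_pos (fun J _ => mul_pos (leftWeight_pos hl _) (rightWeight_pos hl _))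
    ⟨.A .a, Finset.mem_univ _⟩

theorem exists_root : ∃ l : ℝ, 69 / 10 ≤ l ∧ l ≤ 7 ∧
    l ^ 4 = 6 * l ^ 3 + 6 * l ^ 2 + 6 * l - 1 := by
  have := intermediate_value_Icc (show (69 / 10 : ℝ) ≤ 7 by norm_num)
    (f := fun l : ℝ => l ^ 4 - 6 * l ^ 3 - 6 * l ^ 2 - 6 * l + 1) (by fun_prop)
  obtain ⟨l, ⟨h1, h2⟩, hl⟩ := this (show (0 : ℝ) ∈ _ by constructor <;> norm_num)
  exact ⟨l, h1, h2, by dsimp only at hl; linarith⟩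

/-- The eigenvalue and the eigenvectors are determined by `IsPerron`. -/
theorem IsPerron.eq_weights {lam : ℝ} {u v : State → ℝ} (h : IsPerron lam u v) :
    69 / 10 ≤ lam ∧ lam ≤ 7 ∧
      ∀ J K, u J * v K = leftWeight lam J.ty * rightWeight lam K.ty / totalWeight lam := by
  obtain ⟨l, hl1, hl2, h4⟩ := exists_root
  have hl6 : 6 ≤ l := by linarith
  have hne : Nonempty State := ⟨.A .a⟩
  -- Pairing the explicit left eigenvector for `l` with the positive right eigenvector `v` for `lam`
  -- gives a positive number multiplied by both eigenvalues.
  have hlam : lam = l := by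
    have h1 := Matrix.dotProduct_mulVec (fun J => leftWeight l J.ty) transition v
    rw [h.right_eigen, vecMul_leftWeight h4, dotProduct_smul, smul_dotProduct] at h1
    refine mul_right_cancel₀ (ne_of_gt ?_) h1
    exact Finset.sum_pos (fun J _ => mul_pos (leftWeight_pos hl6 _) (h.v_pos J))
      Finset.univ_nonempty
  subst hlam
  have hv := exists_pos_smul_of_irreducible transition transition_nonneg (fun J K => by
    simp_rw [transition_pos_iff]; exact J.reflTransGen_succ K) lam v
    (fun J => rightWeight lam J.ty) h.v_pos (fun J => rightWeight_pos hl6 _) h.right_eigen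
    (mulVec_rightWeight h4)
  have hu := exists_pos_smul_of_irreducible transition.transpose
    (fun i j => transition_nonneg j i) (fun J K => by
    simp_rw [Matrix.transpose_apply, transition_pos_iff]
    exact (Relation.reflTransGen_swap.2 (K.reflTransGen_succ J))) lam u
    (fun J => leftWeight lam J.ty) h.u_pos (fun J => leftWeight_pos hl6 _)
    (by rw [Matrix.mulVec_transpose]; exact h.left_eigen)
    (by rw [Matrix.mulVec_transpose]; exact vecMul_leftWeight h4)
  obtain ⟨c, hc, hv⟩ := hv
  obtain ⟨d, hd, hu⟩ := hu
  -- Normalization fixes only the product of the two scaling factors; this is enough, as only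
  -- products `u J * v K` enter the measure.
  have hn : d * c * totalWeight lam = 1 := by
    rw [← h.normalized, totalWeight, Finset.mul_sum]
    refine Finset.sum_congr rfl fun J _ => ?_
    rw [hu, hv]; ring
  refine ⟨hl1, hl2, fun J K => ?_⟩
  rw [hu, hv, eq_div_iff (totalWeight_pos hl6).ne']
  linear_combination leftWeight lam J.ty * rightWeight lam K.ty * hn

instance : IsProbabilityMeasure parryMeasure := isParryMeasure_parryMeasure.1

theorem exists_perronRoot : ∃ l : ℝ, 69 / 10 ≤ l ∧ l ≤ 7 ∧
    ∀ (m : ℤ) (n : ℕ) (w : ℕ → State),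
      parryMeasure.real {x | ∀ i ≤ n, x.1 (m + i) = w i} =
        leftWeight l (w 0).ty * rightWeight l (w n).ty / totalWeight l / l ^ n *
          ∏ i ∈ Finset.range n, transition (w i) (w (i + 1)) := by
  obtain ⟨-, l, u, v, h, hcyl⟩ := isParryMeasure_parryMeasure
  obtain ⟨h1, h2, huv⟩ := h.eq_weights
  refine ⟨l, h1, h2, fun m n w => ?_⟩
  -- The factors `v` telescope, so a cylinder's mass depends only on its end states, its length and
  -- admissibility.
  have key : u (w 0) * v (w 0) * ∏ i ∈ Finset.range n,
      transition (w i) (w (i + 1)) * v (w (i + 1)) / (l * v (w i)) =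
      u (w 0) * v (w n) / l ^ n * ∏ i ∈ Finset.range n, transition (w i) (w (i + 1)) := by
    induction n with
    | zero => simp
    | succ n ih =>
      have := (h.v_pos (w n)).ne'
      have := h.lam_pos.ne'
      rw [Finset.prod_range_succ, ← mul_assoc, ih, Finset.prod_range_succ, pow_succ]
      field_simp
  rw [measureReal_def, hcyl, ENNReal.toReal_ofReal, key, huv]
  rw [key]
  have := fun J => (h.u_pos J).le
  have := fun J => (h.v_pos J).le
  have := h.lam_pos.le
  exact mul_nonneg (div_nonneg (mul_nonneg (by simp [*]) (by simp [*])) (by positivity))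
    (Finset.prod_nonneg fun i _ => transition_nonneg _ _)

/-- The dominant eigenvalue of the transition matrix. -/
noncomputable def perronRoot : ℝ := exists_perronRoot.choose

theorem le_perronRoot : 69 / 10 ≤ perronRoot := exists_perronRoot.choose_spec.1

theorem perronRoot_le : perronRoot ≤ 7 := exists_perronRoot.choose_spec.2.1

theorem parryMeasure_cylinder (m : ℤ) (n : ℕ) (w : ℕ → State) :
    parryMeasure.real {x | ∀ i ≤ n, x.1 (m + i) = w i} =
      leftWeight perronRoot (w 0).ty * rightWeight perronRoot (w n).ty /
        totalWeight perronRoot / perronRoot ^ n *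
          ∏ i ∈ Finset.range n, transition (w i) (w (i + 1)) :=
  exists_perronRoot.choose_spec.2.2 m n w

theorem leftWeight_perronRoot_pos (t : Fin 8) : 0 < leftWeight perronRoot t :=
  leftWeight_pos (by linarith [le_perronRoot]) t

theorem rightWeight_perronRoot_pos (t : Fin 8) : 0 < rightWeight perronRoot t :=
  rightWeight_pos (by linarith [le_perronRoot]) t

theorem totalWeight_perronRoot_pos : 0 < totalWeight perronRoot :=
  totalWeight_pos (by linarith [le_perronRoot])

theorem perronRoot_pos : 0 < perronRoot := by linarith [le_perronRoot]

/-! ### Spine cylinders and geometric decay of the Hoeffding projections -/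

/-- This determinism of the spine map is what makes lifts of spine words unique once the first state
is given. -/
theorem State.eq_of_spine_eq {J K K' : State} (hK : K ∈ J.succ) (hK' : K' ∈ J.succ)
    (h : K.spine = K'.spine) : K = K' := by
  have : ∀ J ∈ State.all, ∀ K ∈ J.succ, ∀ K' ∈ J.succ, K.spine = K'.spine → K = K' := by
    decide +kernel
  exact this J J.mem_all K hK K' hK' h

/-- The sequence of states that starts at `J` and has the spine `s`, as long as there is one. -/
def State.lift (J : State) (s : ℕ → Spine) : ℕ → State
  | 0 => J
  | i + 1 => ((State.lift J s i).succ.find? fun K => K.spine = s (i + 1)).getD J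

theorem State.eq_lift {n : ℕ} {s : ℕ → Spine} {x : ℕ → State}
    (hx : ∀ i < n, x (i + 1) ∈ (x i).succ) (hs : ∀ i ≤ n, (x i).spine = s i) :
    ∀ i ≤ n, x i = (x 0).lift s i := by
  intro i
  induction i with
  | zero => exact fun _ => rfl
  | succ i ih =>
    intro hi
    have h := hx i (by omega)
    rw [State.lift, ← ih (by omega)]
    -- The default value in `State.lift` is never reached here: `x (i + 1)` itself is a successor
    -- with the required letter.
    cases hf : (x i).succ.find? (fun K => K.spine = s (i + 1)) with
    | none =>
      rw [List.find?_eq_none] at hf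
      have := hf _ h
      simp only [decide_eq_true_eq] at this
      exact absurd (hs _ hi) this
    | some K =>
      have h1 := List.mem_of_find?_eq_some hf
      have h2 : K.spine = s (i + 1) := by simpa using List.find?_some hf
      exact State.eq_of_spine_eq h h1 ((hs _ hi).trans h2.symm)

/-- The sum of the left weights of the states with a given spine letter. -/
noncomputable def spineWeight (s : Spine) : ℝ :=
  ∑ J : State, if J.spine = s then leftWeight perronRoot J.ty else 0

/-- The event is covered by one state cylinder for each initial state over `s 0`. Summing left
weights over these states produces `spineWeight`, while `R` bounds the right weight at the far end.
-/
theorem parryMeasure_spine_le (m : ℤ) (n : ℕ) (s : ℕ → Spine) {R : ℝ} (hR0 : 0 ≤ R)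
    (hR : ∀ K : State, K.spine = s n → rightWeight perronRoot K.ty ≤ R) :
    parryMeasure.real {x | ∀ i ≤ n, (x.1 (m + i)).spine = s i} ≤
      spineWeight (s 0) * R / totalWeight perronRoot / perronRoot ^ n := by
  classical
  have hsub : {x : SnakeShift | ∀ i ≤ n, (x.1 (m + i)).spine = s i} ⊆
      ⋃ J ∈ Finset.univ.filter (fun J : State => J.spine = s 0 ∧ (J.lift s n).spine = s n),
        {x | ∀ i ≤ n, x.1 (m + i) = J.lift s i} := by
    intro x hx
    have h := State.eq_lift (n := n) (s := s) (x := fun i : ℕ => x.1 (m + i)) (fun i _ => by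
      have := x.2 (m + i)
      rwa [add_assoc] at this) hx
    refine Set.mem_biUnion (x := x.1 (m + (0 : ℕ))) ?_ h
    have h1 := hx n le_rfl
    rw [h n le_rfl] at h1
    rw [Finset.coe_filter]
    exact ⟨Finset.mem_univ _, hx 0 (Nat.zero_le _), h1⟩
  refine (measureReal_mono hsub (measure_ne_top _ _)).trans
    ((measureReal_biUnion_finset_le _ _).trans ?_)
  have hl := perronRoot_pos
  have hZ := totalWeight_perronRoot_pos
  rw [spineWeight, ← Finset.sum_filter, Finset.sum_mul, Finset.sum_div, Finset.sum_div]
  -- The condition on the last letter of the lift is kept in the filter because the bound `R`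
  -- applies only to states carrying that letter.
  have hterm : ∀ J ∈ Finset.univ.filter
      (fun J : State => J.spine = s 0 ∧ (J.lift s n).spine = s n),
      parryMeasure.real {x | ∀ i ≤ n, x.1 (m + i) = J.lift s i} ≤
        leftWeight perronRoot J.ty * R / totalWeight perronRoot / perronRoot ^ n := by
    intro J hJ
    have hJ := (Finset.mem_filter.1 hJ).2
    have hf := leftWeight_perronRoot_pos J.ty
    have hg := rightWeight_perronRoot_pos (J.lift s n).ty
    have hgR := hR _ hJ.2
    rw [parryMeasure_cylinder]
    calc _ ≤ leftWeight perronRoot J.ty * rightWeight perronRoot (J.lift s n).ty /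
          totalWeight perronRoot / perronRoot ^ n * 1 := by
          refine mul_le_mul_of_nonneg_left ?_ ?_
          · refine Finset.prod_le_one (fun i _ => transition_nonneg _ _) fun i _ => ?_
            unfold transition; split_ifs <;> norm_num
          · exact div_nonneg (div_nonneg (mul_nonneg hf.le hg.le) hZ.le) (by positivity)
      _ ≤ _ := by rw [mul_one]; gcongr
  refine (Finset.sum_le_sum hterm).trans ?_
  refine Finset.sum_le_sum_of_subset_of_nonneg ?_ fun J _ _ => ?_
  · exact Finset.monotone_filter_right _ fun J _ h => h.1
  · have hf := leftWeight_perronRoot_pos J.ty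
    positivity

theorem Gen.inv_inv (x : Gen) : x.inv.inv = x := by cases x <;> rfl

theorem Spine.bar_bar (s : Spine) : s.bar.bar = s := by
  cases s <;> simp [Spine.bar, Gen.inv_inv]

theorem uKernel_le_indicator {X : Type*} (E : Set X) (k : ℕ) (ζ ξ : ℕ → Spine) (x : X)
    (h : (∀ i, 1 < i → i < k → ζ i = ξ i) → IsLinked ζ ξ k → x ∈ E) :
    (uKernel k ζ ξ : ℝ) ≤ E.indicator (fun _ => 1) x := by
  unfold uKernel
  split_ifs with hc
  · rw [Set.indicator_of_mem (h hc.2.2.1 hc.2.2.2)]; simp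
  · simpa using Set.indicator_nonneg (fun _ _ => zero_le_one) x

theorem measurableSet_spine (m : ℤ) (n : ℕ) (s : ℕ → Spine) :
    MeasurableSet {x : SnakeShift | ∀ i ≤ n, (x.1 (m + i)).spine = s i} := by
  have : {x : SnakeShift | ∀ i ≤ n, (x.1 (m + i)).spine = s i} =
      ⋂ i, ⋂ (_ : i ≤ n), (fun x : SnakeShift => x.1 (m + (i : ℕ))) ⁻¹' {J | J.spine = s i} := by
    ext; simp
  rw [this]
  exact MeasurableSet.iInter fun i => MeasurableSet.iInter fun _ =>
    ((measurable_pi_apply _).comp measurable_subtype_coe) (MeasurableSet.of_discrete)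

theorem hKernel_nonneg (k : ℕ) (x y : SnakeShift) : 0 ≤ hKernel k x y := by
  unfold hKernel; positivity

theorem hoeffding_nonneg (k : ℕ) (z : SnakeShift) : 0 ≤ hoeffding k z :=
  integral_nonneg fun _ => hKernel_nonneg k z _

theorem hoeffding_le_measureReal {k : ℕ} {z : SnakeShift} {E F : Set SnakeShift}
    (hE : MeasurableSet E) (hF : MeasurableSet F)
    (h1 : ∀ Z : SnakeShift, (uKernel k z.spine Z.spine : ℝ) ≤ E.indicator (fun _ => 1) Z)
    (h2 : ∀ Z : SnakeShift, (vKernel k z.spine Z.spine : ℝ) ≤ F.indicator (fun _ => 1) Z) :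
    hoeffding k z ≤ parryMeasure.real E + parryMeasure.real F := by
  have hEi : Integrable (E.indicator fun _ => (1 : ℝ)) parryMeasure :=
    (integrable_const _).indicator hE
  have hFi : Integrable (F.indicator fun _ => (1 : ℝ)) parryMeasure :=
    (integrable_const _).indicator hF
  rw [← integral_indicator_one hE, ← integral_indicator_one hF]
  -- Only the dominating indicators need to be integrable, so measurability of the kernel is not
  -- required.
  refine (integral_mono_of_nonneg (.of_forall fun Z => hKernel_nonneg k z Z) (hEi.add hFi)
    (.of_forall fun Z => ?_)).trans_eq (integral_add hEi hFi)
  exact add_le_add (h1 Z) (h2 Z)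

/-- With `k = n + 3`, the letters of `Z` at times `2, …, n + 2` are forced: for `u_k` they are those
of `z`, for `v_k` the inverses in reverse order. Hence each of `L` and `R` must cover one end of `z`
and the inverse of the other. -/
theorem hoeffding_le (z : SnakeShift) (n : ℕ) {L R : ℝ} (hR0 : 0 ≤ R)
    (hL : spineWeight (z.spine 2) ≤ L) (hL' : spineWeight (z.spine (n + 2)).bar ≤ L)
    (hR : ∀ K : State, K.spine = z.spine (n + 2) → rightWeight perronRoot K.ty ≤ R)
    (hR' : ∀ K : State, K.spine = (z.spine 2).bar → rightWeight perronRoot K.ty ≤ R) :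
    hoeffding (n + 3) z ≤
      2 * (L * R / totalWeight perronRoot) * (perronRoot⁻¹) ^ n := by
  have hl := perronRoot_pos
  have hZ := totalWeight_perronRoot_pos
  have h1 := parryMeasure_spine_le 2 n (fun i => z.spine (2 + i)) hR0
    (fun K hK => hR K (by rwa [add_comm] at hK))
  have h2 := parryMeasure_spine_le 2 n (fun i => (z.spine (n + 2 - i)).bar) hR0
    (fun K hK => hR' K (by rwa [Nat.add_sub_cancel_left] at hK))
  have h3 : spineWeight (z.spine (2 + 0)) * R / totalWeight perronRoot / perronRoot ^ n ≤
      L * R / totalWeight perronRoot / perronRoot ^ n := by gcongr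
  have h4 : spineWeight (z.spine (n + 2 - 0)).bar * R / totalWeight perronRoot / perronRoot ^ n ≤
      L * R / totalWeight perronRoot / perronRoot ^ n := by gcongr; exact hL'
  have := hoeffding_le_measureReal (k := n + 3) (z := z) (measurableSet_spine 2 n _)
    (measurableSet_spine 2 n _)
    (fun Z => uKernel_le_indicator {x : SnakeShift | ∀ i ≤ n, (x.1 (2 + i)).spine =
      (fun i => z.spine (2 + i)) i} _ _ _ Z fun hm _ i hi => ?_)
    (fun Z => uKernel_le_indicator {x : SnakeShift | ∀ i ≤ n, (x.1 (2 + i)).spine =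
      (fun i => (z.spine (n + 2 - i)).bar) i} _ _ _ Z fun hm _ i hi => ?_)
  · refine this.trans ((add_le_add (h1.trans h3) (h2.trans h4)).trans_eq ?_)
    rw [inv_pow]; ring
  · exact (hm (2 + i) (by omega) (by omega)).symm
  · have h := congrArg Spine.bar (hm (n + 2 - i) (by omega) (by omega))
    rw [Spine.bar_bar, show n + 3 + 1 - (n + 2 - i) = 2 + i by omega] at h
    exact h.symm

theorem summable_hoeffding (z : SnakeShift) : Summable fun k : ℕ => hoeffding (k + 1) z := by
  have hl := le_perronRoot
  -- `H_1` and `H_2` are set aside, since their kernels impose no agreement of interior letters.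
  rw [← summable_nat_add_iff 2]
  have hR : ∀ K : State, rightWeight perronRoot K.ty ≤
      ∑ t, rightWeight perronRoot t := fun K =>
    Finset.single_le_sum (f := rightWeight perronRoot)
      (fun t _ => (rightWeight_perronRoot_pos t).le) (Finset.mem_univ _)
  have hL : ∀ s, spineWeight s ≤ ∑ J : State, leftWeight perronRoot J.ty := fun s =>
    Finset.sum_le_sum fun J _ => by
      split_ifs
      · exact le_rfl
      · exact (leftWeight_perronRoot_pos _).le
  refine Summable.of_nonneg_of_le (fun k => hoeffding_nonneg _ _)
    (fun k => hoeffding_le z k (Finset.sum_nonneg fun t _ => (rightWeight_perronRoot_pos t).le)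
      (hL _) (hL _) (fun K _ => hR K) (fun K _ => hR K)) ?_
  exact (summable_geometric_of_lt_one (by positivity)
    (inv_lt_one_of_one_lt₀ (by linarith))).mul_left _

/-! ### Vanishing and upper bounds for spines inside octagons -/

theorem orientation_eq_zero {O w : List Spine} {s : Spine} (hs : s ∈ w) (hO : s ∉ O) :
    orientation O w = 0 := by
  unfold orientation
  rw [if_neg, if_neg]
  · rintro ⟨r, hr, h⟩
    exact hO (List.mem_reverse.1 ((List.mem_cyclicPermutations_iff.1 hr).mem_iff.1 (h.subset hs)))
  · rintro ⟨r, hr, h⟩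
    exact hO ((List.mem_cyclicPermutations_iff.1 hr).mem_iff.1 (h.subset hs))

/-- For `k ≥ 2` every linking condition needs a nonzero orientation of a word starting with the
inverse of `ζ 1`, and `γ` is its own inverse and occurs in neither order. As `ξ` is arbitrary, this
disposes of `u_k` and `v_k` together. -/
theorem not_isLinked_of_ga {ζ ξ : ℕ → Spine} (h : ζ 1 = .ga) (k : ℕ) : ¬ IsLinked ζ ξ k := by
  have h1 : ∀ l, o₁ ((ζ 1).bar :: l) = 0 := fun l =>
    orientation_eq_zero List.mem_cons_self (by rw [h]; decide)
  have h2 : ∀ l, o₂ ((ζ 1).bar :: l) = 0 := fun l =>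
    orientation_eq_zero List.mem_cons_self (by rw [h]; decide)
  match k with
  | 0 => exact id
  | 1 => simp [IsLinked, h]
  | 2 => simp [IsLinked, h1]
  | 3 =>
    simp only [IsLinked, h1]
    exact fun h => h.2 h.1.symm
  | 4 =>
    simp only [IsLinked, h1, h2]
    rintro (h | h)
    · exact h.2 h.1.symm
    · exact zero_ne_one h
  | k + 5 =>
    simp only [IsLinked, h1, h2]
    exact fun h => h.2 h.1.symm

/-- For `k = 2` only the order at a vertex matters, and it contains no letter `ε`. -/
theorem not_isLinked_two_of_ep {ζ ξ : ℕ → Spine} {y : Gen} (h : ζ 1 = .ep y) :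
    ¬ IsLinked ζ ξ 2 := by
  have h1 : ∀ l, o₁ ((ζ 1).bar :: l) = 0 := fun l =>
    orientation_eq_zero List.mem_cons_self (by
      have : ∀ y, (Spine.ep y).bar ∉ order₁ := by decide
      rw [h]; exact this y)
  simp [IsLinked, h1]

theorem uKernel_eq_zero {k : ℕ} {ζ ξ : ℕ → Spine} (h : ¬ IsLinked ζ ξ k) : uKernel k ζ ξ = 0 :=
  if_neg fun hc => h hc.2.2.2

theorem hoeffding_eq_zero {k : ℕ} {z : SnakeShift} (h : ∀ ξ, ¬ IsLinked z.spine ξ k) :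
    hoeffding k z = 0 := by
  simp [hoeffding, hKernel, vKernel, uKernel_eq_zero (h _)]

theorem totalHoeffding_eq_zero {z : SnakeShift} (h : z.spine 1 = .ga) : totalHoeffding z = 0 := by
  simp [totalHoeffding, hoeffding_eq_zero fun _ => not_isLinked_of_ga h _]

theorem spineWeight_eq {s : Spine} {c : Fin 8 → ℕ}
    (h : ∀ t, ((State.all.filter fun J => J.spine = s).map State.ty).count t = c t) :
    spineWeight s = ∑ t, (c t : ℝ) * leftWeight perronRoot t := by
  rw [spineWeight, sum_ty_list (leftWeight perronRoot) (fun J => J.spine = s)]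
  simp_rw [h]

theorem spineWeight_al (x : Gen) :
    spineWeight (.al x) = perronRoot ^ 3 + perronRoot ^ 2 + perronRoot - 1 := by
  rw [spineWeight_eq (c := ![1, 2, 2, 0, 0, 0, 0, 0]) (by revert x; decide +kernel)]
  simp [Fin.sum_univ_eight, leftWeight]
  ring

theorem spineWeight_ga : spineWeight .ga = 8 * (perronRoot ^ 2 + perronRoot) := by
  rw [spineWeight_eq (c := ![0, 0, 0, 0, 8, 8, 0, 0]) (by decide +kernel)]
  simp [Fin.sum_univ_eight, leftWeight]
  ring

theorem spineWeight_ep (y : Gen) : spineWeight (.ep y) = 2 := by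
  rw [spineWeight_eq (c := ![0, 0, 0, 0, 0, 0, 0, 2]) (by revert y; decide +kernel)]
  simp [Fin.sum_univ_eight, leftWeight]

/-- The spine letters inside an octagon. -/
def Spine.IsInner (s : Spine) : Prop := s = .ga ∨ ∃ y, s = .ep y

theorem Spine.IsInner.bar {s : Spine} (h : s.IsInner) : s.bar.IsInner := by
  rcases h with rfl | ⟨y, rfl⟩
  · exact .inl rfl
  · exact .inr ⟨y.inv, rfl⟩

theorem spineWeight_le_of_isInner {s : Spine} (h : s.IsInner) :
    spineWeight s ≤ 8 * (perronRoot ^ 2 + perronRoot) := by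
  have hl := le_perronRoot
  rcases h with rfl | ⟨y, rfl⟩
  · exact spineWeight_ga.le
  · rw [spineWeight_ep]; nlinarith

/-- Only `C`, `C'` and `E` lie over inner letters; the maximum is attained at `C'`. The gain from
cubic to quadratic size keeps the tail of `H` small on the octagon orbit. -/
theorem rightWeight_le_of_isInner {K : State} (h : K.spine.IsInner) :
    rightWeight perronRoot K.ty ≤ perronRoot ^ 2 := by
  have hl := le_perronRoot
  rcases K with x | ⟨s, x⟩ | ⟨s, x⟩ | k | k | k | k | ⟨s, y⟩
  case E => simp only [State.ty, rightWeight, Matrix.cons_val]; nlinarith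
  case C => simp [State.ty, rightWeight]; nlinarith
  case Cp => simp [State.ty, rightWeight]
  all_goals simp [Spine.IsInner, State.spine] at h

theorem rightWeight_le_of_al {K : State} {x : Gen} (h : K.spine = .al x) :
    rightWeight perronRoot K.ty ≤ perronRoot ^ 3 + perronRoot ^ 2 + perronRoot - 1 := by
  have hl := le_perronRoot
  rcases K with x | ⟨s, x⟩ | ⟨s, x⟩ | k | k | k | k | ⟨s, y⟩
  case A => simp [State.ty, rightWeight]
  case Ap => simp [State.ty, rightWeight]; nlinarith
  case App => simp [State.ty, rightWeight]; nlinarith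
  case E => cases s <;> simp [State.spine] at h
  all_goals simp [State.spine] at h

/-- Linking at `k = 1` forces the first letter of `Z` to be `α_y` (for `u_1`) or its inverse (for
`v_1`). The square arises because the total left weight over `α_x` and the largest right weight over
it are the same polynomial. -/
theorem hoeffding_one_le {z : SnakeShift} {y : Gen} (h : z.spine 1 = .ep y) :
    hoeffding 1 z ≤ 2 * ((perronRoot ^ 3 + perronRoot ^ 2 + perronRoot - 1) ^ 2 /
      totalWeight perronRoot) := by
  have hl := le_perronRoot
  have hg : 0 ≤ perronRoot ^ 3 + perronRoot ^ 2 + perronRoot - 1 := by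
    nlinarith [sq_nonneg perronRoot, pow_pos perronRoot_pos 3]
  have hm : ∀ x, parryMeasure.real
      {Z : SnakeShift | ∀ i ≤ 0, (Z.1 (1 + (i : ℕ))).spine = (fun _ => Spine.al x) i} ≤
      (perronRoot ^ 3 + perronRoot ^ 2 + perronRoot - 1) ^ 2 / totalWeight perronRoot := fun x =>
    (parryMeasure_spine_le 1 0 (fun _ => Spine.al x) hg
      (fun _ hK => rightWeight_le_of_al hK)).trans_eq (by rw [spineWeight_al]; ring)
  have := hoeffding_le_measureReal (k := 1) (z := z)
    (measurableSet_spine 1 0 fun _ => .al y) (measurableSet_spine 1 0 fun _ => .al y.inv)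
    (fun Z => uKernel_le_indicator _ _ _ _ Z fun _ hk i hi => ?_)
    (fun Z => uKernel_le_indicator _ _ _ _ Z fun _ hk i hi => ?_)
  · exact this.trans ((add_le_add (hm y) (hm y.inv)).trans_eq (by ring))
  · obtain ⟨x, ⟨h1, -⟩ | ⟨h1, h2⟩⟩ := hk
    · simp [h] at h1
    · obtain rfl : i = 0 := by omega
      rw [h, Spine.ep.injEq] at h1
      rw [h1]
      exact h2
  · obtain ⟨x, ⟨h1, -⟩ | ⟨h1, h2⟩⟩ := hk
    · simp [h] at h1
    · obtain rfl : i = 0 := by omega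
      rw [h, Spine.ep.injEq] at h1
      rw [h1]
      have := congrArg Spine.bar h2
      rw [Spine.bar_bar] at this
      exact this

theorem totalHoeffding_le {z : SnakeShift} {y : Gen} (h : z.spine 1 = .ep y)
    (hz : ∀ i, (z.spine i).IsInner) :
    totalHoeffding z ≤ 2 * ((perronRoot ^ 3 + perronRoot ^ 2 + perronRoot - 1) ^ 2 /
      totalWeight perronRoot) + 2 * (8 * (perronRoot ^ 2 + perronRoot) * perronRoot ^ 2 /
      totalWeight perronRoot) * (1 - perronRoot⁻¹)⁻¹ := by
  have hl := le_perronRoot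
  have hs := summable_hoeffding z
  rw [totalHoeffding, ← hs.sum_add_tsum_nat_add 2]
  -- The geometric bound starts at `H_3`, so `H_1` and `H_2` are treated by hand.
  have h2 : hoeffding 2 z = 0 := hoeffding_eq_zero fun _ => not_isLinked_two_of_ep h
  simp only [Finset.sum_range_succ, Finset.range_zero, Finset.sum_empty, zero_add]
  have hr := hasSum_geometric_of_lt_one (r := perronRoot⁻¹) (by positivity)
    (inv_lt_one_of_one_lt₀ (by linarith))
  rw [show (1 + 1 : ℕ) = 2 from rfl, h2, add_zero]
  refine add_le_add (hoeffding_one_le h) ?_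
  rw [← (hr.mul_left _).tsum_eq]
  refine Summable.tsum_le_tsum (fun n => ?_) ((summable_nat_add_iff 2).2 hs)
    (hr.mul_left _).summable
  exact hoeffding_le z n (by positivity) (spineWeight_le_of_isInner (hz _))
    (spineWeight_le_of_isInner (hz _).bar)
    (fun K hK => rightWeight_le_of_isInner (hK ▸ hz _))
    (fun K hK => rightWeight_le_of_isInner (hK ▸ (hz _).bar))

/-! ### The fixed point: a lower bound for `H_2` -/

/-- The sequence `⋯ A_a A_a A_a ⋯`. -/
def axisPoint : SnakeShift := ⟨fun _ => .A .a, fun _ =>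
  show State.A .a ∈ (State.A .a).succ by decide⟩

/-- Ten pairs of consecutive states of type `A` that cross `(A_a, A_a)`, directly or reversed. -/
def crossingPairs : List (State × State) :=
  [(.A .b, .A .d), (.A .b, .A .C), (.A .b, .A .D), (.A .b, .A .c), (.A .b, .A .b),
    (.A .d, .A .B), (.A .C, .A .B), (.A .D, .A .B), (.A .c, .A .B), (.A .B, .A .B)]

theorem uKernel_two (ζ ξ : ℕ → Spine) : uKernel 2 ζ ξ =
    if ζ 1 ≠ ξ 1 ∧ ζ 2 ≠ ξ 2 ∧ o₁ [(ζ 1).bar, (ξ 1).bar, ζ 2, ξ 2] = 1 then 1 else 0 := by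
  unfold uKernel
  congr 1
  refine propext (and_congr_right fun _ => and_congr_right fun _ => and_iff_right ?_)
  intro i h1 h2
  omega

/-- The kernel `h_2` as a function of the letters at times `1` and `2`. -/
def hKernelTwo (p q : State × State) : ℕ :=
  (if p.1.spine ≠ q.1.spine ∧ p.2.spine ≠ q.2.spine ∧
    o₁ [p.1.spine.bar, q.1.spine.bar, p.2.spine, q.2.spine] = 1 then 1 else 0) +
  (if p.1.spine ≠ q.2.spine.bar ∧ p.2.spine ≠ q.1.spine.bar ∧
    o₁ [p.1.spine.bar, q.2.spine.bar.bar, p.2.spine, q.1.spine.bar] = 1 then 1 else 0)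

theorem hKernel_two (x y : SnakeShift) :
    hKernel 2 x y = hKernelTwo (x.1 1, x.1 2) (y.1 1, y.1 2) := by
  rw [hKernel, vKernel, uKernel_two, uKernel_two, hKernelTwo, Nat.cast_add]
  have hx : ∀ i : ℕ, x.spine i = (x.1 i).spine := fun _ => rfl
  have hy : ∀ i : ℕ, y.spine i = (y.1 i).spine := fun _ => rfl
  simp only [hx, hy, Nat.reduceAdd, Nat.reduceSub, Nat.cast_one, Nat.cast_ofNat]

/-- In the vertex order, `B` is the only edge strictly between `A` and `a` on one side, and `d, C,
D, c, b` lie on the other. A path entering along `b`, that is from the side of `B`, and leaving by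
one of these five crosses the axis; the other five pairs are the reversed paths. -/
theorem one_le_hKernelTwo : ∀ q ∈ crossingPairs, 1 ≤ hKernelTwo (.A .a, .A .a) q := by
  rw [← List.forall_iff_forall_mem]
  decide +kernel

theorem le_hoeffding_two_axisPoint :
    10 * (leftWeight perronRoot 0 * rightWeight perronRoot 0 /
      totalWeight perronRoot / perronRoot) ≤ hoeffding 2 axisPoint := by
  -- All ten cylinders have the same mass because both states of each pair are of type `A`.
  have hcyl : ∀ q ∈ crossingPairs, parryMeasure.real
      {x : SnakeShift | ∀ i ≤ 1, x.1 (1 + (i : ℕ)) = (fun j => if j = 0 then q.1 else q.2) i} =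
        leftWeight perronRoot 0 * rightWeight perronRoot 0 /
          totalWeight perronRoot / perronRoot := by
    intro q hq
    have h : ∀ q ∈ crossingPairs, q.1.ty = 0 ∧ q.2.ty = 0 ∧ q.2 ∈ q.1.succ := by
      rw [← List.forall_iff_forall_mem]
      decide +kernel
    obtain ⟨h1, h2, h3⟩ := h q hq
    rw [parryMeasure_cylinder]
    simp [h1, h2, transition, h3]
  have hset : ∀ q : State × State,
      {x : SnakeShift | ∀ i ≤ 1, x.1 (1 + (i : ℕ)) = (fun j => if j = 0 then q.1 else q.2) i} =
        {x | (x.1 1, x.1 2) = q} := by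
    intro q
    ext x
    constructor
    · intro h
      exact Prod.ext (h 0 zero_le_one) (h 1 le_rfl)
    · rintro rfl i hi
      interval_cases i <;> rfl
  have hmeas : Measurable fun x : SnakeShift => (x.1 1, x.1 2) :=
    ((measurable_pi_apply (1 : ℤ)).comp measurable_subtype_coe).prodMk
      ((measurable_pi_apply (2 : ℤ)).comp measurable_subtype_coe)
  have hE : MeasurableSet {x : SnakeShift | (x.1 1, x.1 2) ∈ crossingPairs} :=
    hmeas (t := {q | q ∈ crossingPairs}) MeasurableSet.of_discrete
  have hval : parryMeasure.real {x : SnakeShift | (x.1 1, x.1 2) ∈ crossingPairs} =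
      10 * (leftWeight perronRoot 0 * rightWeight perronRoot 0 /
        totalWeight perronRoot / perronRoot) := by
    have : {x : SnakeShift | (x.1 1, x.1 2) ∈ crossingPairs} =
        ⋃ q ∈ crossingPairs.toFinset, {x : SnakeShift | (x.1 1, x.1 2) = q} := by ext; simp
    rw [this, measureReal_biUnion_finset]
    · rw [Finset.sum_congr rfl fun q hq => (congrArg _ (hset q).symm).trans
          (hcyl q (List.mem_toFinset.1 hq)),
        Finset.sum_const, List.toFinset_card_of_nodup (by decide +kernel)]
      simp [crossingPairs]
    · intro q _ q' _ hqq
      exact Set.disjoint_left.2 fun x hx hx' => hqq (hx.symm.trans hx')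
    · exact fun q _ => hmeas (measurableSet_singleton q)
  rw [← hval, ← integral_indicator_one hE]
  have hpt : ∀ Z, hKernel 2 axisPoint Z =
      (hKernelTwo (.A .a, .A .a) (Z.1 1, Z.1 2) : ℝ) := fun Z => hKernel_two _ _
  refine integral_mono_of_nonneg
    (.of_forall fun x => Set.indicator_nonneg (fun _ _ => zero_le_one) x) ?_
    (.of_forall fun x => ?_)
  -- For a lower bound the kernel itself must be integrable: it depends on two coordinates only and
  -- is a sum of two indicators, hence at most 2.
  · rw [show hKernel 2 axisPoint = _ from funext hpt]
    refine Integrable.of_bound (C := 2) ?_ (.of_forall fun x => ?_)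
    · exact ((measurable_of_finite
        fun q => (hKernelTwo (.A .a, .A .a) q : ℝ)).comp hmeas).aestronglyMeasurable
    · rw [Real.norm_natCast, hKernelTwo]
      split_ifs <;> norm_num
  · rw [hpt]
    by_cases hx : (x.1 1, x.1 2) ∈ crossingPairs
    · rw [Set.indicator_of_mem (by exact hx)]
      exact Nat.one_le_cast.2 (one_le_hKernelTwo _ hx)
    · rw [Set.indicator_of_notMem (by exact hx)]
      positivity

/-! ### The octagon orbit of period six -/

/-- The states of a closed path around octagons. -/
def octagonCycle : ZMod 6 → State :=
  ![.C .a, .Cp .b, .E .left .b, .C .A, .Cp .B, .E .left .D]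

/-- The periodic sequence of states along `octagonCycle`, starting at `j`. -/
def octagonPoint (j : ZMod 6) : SnakeShift :=
  ⟨fun i => octagonCycle (i + j), fun i => by
    have : ∀ j, octagonCycle (j + 1) ∈ (octagonCycle j).succ := by decide
    have h := this (i + j)
    rwa [show (i : ZMod 6) + j + 1 = ((i + 1 : ℤ) : ZMod 6) + j by push_cast; ring] at h⟩

theorem shift_octagonPoint (j : ZMod 6) : (octagonPoint j).shift = octagonPoint (j + 1) := by
  refine Subtype.ext (funext fun i => ?_)
  change octagonCycle (((i + 1 : ℤ) : ZMod 6) + j) = octagonCycle (i + (j + 1))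
  congr 1
  push_cast
  ring

theorem octagonCycle_spine (j : ZMod 6) : (octagonCycle j).spine.IsInner := by
  have : ∀ j, (octagonCycle j).spine = .ga ∨ ∃ y, (octagonCycle j).spine = .ep y := by decide
  exact this j

theorem sum_totalHoeffding_octagonPoint :
    ∑ j, totalHoeffding (octagonPoint j) ≤
      2 * (2 * ((perronRoot ^ 3 + perronRoot ^ 2 + perronRoot - 1) ^ 2 /
      totalWeight perronRoot) + 2 * (8 * (perronRoot ^ 2 + perronRoot) * perronRoot ^ 2 /
      totalWeight perronRoot) * (1 - perronRoot⁻¹)⁻¹) := by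
  -- Kernels read strings from time 1, so the relevant letter of `octagonPoint j` is the one at `1 +
  -- j`.
  have hga : ∀ j, (octagonCycle (1 + j)).spine = .ga → totalHoeffding (octagonPoint j) = 0 :=
    fun j h => totalHoeffding_eq_zero (by simpa [SnakeShift.spine, octagonPoint] using h)
  have hep : ∀ j y, (octagonCycle (1 + j)).spine = .ep y → totalHoeffding (octagonPoint j) ≤ _ :=
    fun j y h => totalHoeffding_le (y := y) (by simpa [SnakeShift.spine, octagonPoint] using h)
      (fun i => octagonCycle_spine (((i : ℕ) : ℤ) + j))
  have h6 : ∑ j, totalHoeffding (octagonPoint j) = totalHoeffding (octagonPoint 0) +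
      totalHoeffding (octagonPoint 1) + totalHoeffding (octagonPoint 2) +
      totalHoeffding (octagonPoint 3) + totalHoeffding (octagonPoint 4) +
      totalHoeffding (octagonPoint 5) := Fin.sum_univ_six fun j => totalHoeffding (octagonPoint j)
  rw [h6, hga 0 rfl, hga 2 rfl, hga 3 rfl, hga 5 rfl]
  have h1 := hep 1 .b rfl
  have h4 := hep 4 .D rfl
  linarith

/-! ### Numerical comparison and conclusion -/

theorem weights_lt {l : ℝ} (h1 : 69 / 10 ≤ l) (h2 : l ≤ 7) :
    2 * (2 * (l ^ 3 + l ^ 2 + l - 1) ^ 2 + 2 * (8 * (l ^ 2 + l) * l ^ 2) * (1 - l⁻¹)⁻¹) <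
      6 * (10 * (leftWeight l 0 * rightWeight l 0 / l)) := by
  have hl : 0 < l := by linarith
  have hinv : (1 - l⁻¹)⁻¹ ≤ 70 / 59 := by
    have : l⁻¹ ≤ 10 / 69 := by
      rw [inv_le_comm₀ hl (by norm_num)]; linarith
    rw [inv_le_comm₀ (by linarith) (by norm_num)]
    linarith
  -- Rounded values suffice: the left side stays below about 738000 and the right side above about
  -- 881000.
  have hs1 : 4761 / 100 ≤ l ^ 2 := by nlinarith
  have hs2 : l ^ 2 ≤ 49 := by nlinarith
  have hc1 : 328 ≤ l ^ 3 := by nlinarith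
  have hc2 : l ^ 3 ≤ 343 := by nlinarith
  have hf : 270 ≤ l ^ 3 - l ^ 2 - l - 1 := by nlinarith
  have hg1 : 381 ≤ l ^ 3 + l ^ 2 + l - 1 := by linarith
  have hg2 : l ^ 3 + l ^ 2 + l - 1 ≤ 398 := by linarith
  have h3 : (l ^ 3 + l ^ 2 + l - 1) ^ 2 ≤ 398 ^ 2 := by gcongr
  have h4 : 2 * (8 * (l ^ 2 + l) * l ^ 2) * (1 - l⁻¹)⁻¹ ≤ 2 * (8 * (49 + 7) * 49) * (70 / 59) := by
    have : 0 ≤ (1 - l⁻¹)⁻¹ := inv_nonneg.2 (sub_nonneg.2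
      (inv_le_one_of_one_le₀ (by linarith)))
    gcongr
  have h5 : (270 * 381 / 7 : ℝ) ≤ (l ^ 3 - l ^ 2 - l - 1) * (l ^ 3 + l ^ 2 + l - 1) / l := by
    gcongr
  simp only [leftWeight, rightWeight, Matrix.cons_val_zero]
  linarith

theorem mainTheorem10 :
    (∀ z : SnakeShift, Summable fun k : ℕ => hoeffding (k + 1) z) ∧
      ¬ IsCohomologousToConst SnakeShift.shift totalHoeffding := by
  refine ⟨summable_hoeffding, ?_⟩
  rintro ⟨c, H₀, -, h⟩
  have hZ := totalWeight_perronRoot_pos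
  -- At a fixed point the coboundary vanishes.
  have haxis : totalHoeffding axisPoint = c := by
    rw [h, show axisPoint.shift = axisPoint from rfl]; ring
  have hsum : ∑ j, totalHoeffding (octagonPoint j) = 6 * c := by
    -- The shift rotates the six points, so the coboundary sums to zero over the orbit.
    have he : ∑ j, H₀ (octagonPoint (j + 1)) = ∑ j, H₀ (octagonPoint j) :=
      Equiv.sum_comp (Equiv.addRight (1 : ZMod 6)) fun j => H₀ (octagonPoint j)
    simp_rw [h, shift_octagonPoint, Finset.sum_sub_distrib, Finset.sum_add_distrib, he]
    simp [ZMod.card]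
  -- The series for `H` is indexed from `k + 1`, so `H_2` is its term of index 1.
  have hle : hoeffding 2 axisPoint ≤ c :=
    haxis ▸ (summable_hoeffding axisPoint).le_tsum 1 fun _ _ => hoeffding_nonneg _ _
  have h1 := le_hoeffding_two_axisPoint.trans hle
  have h2 := hsum ▸ sum_totalHoeffding_octagonPoint
  have h3 := div_lt_div_of_pos_right (weights_lt le_perronRoot perronRoot_le) hZ
  refine lt_irrefl (6 * c) (h2.trans_lt (lt_of_lt_of_le ?_ (mul_le_mul_of_nonneg_left h1 ?_)))
  · convert h3 using 1 <;> ring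
  · norm_num
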